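/- **Setting.** Let $G=(V,E)$ be a finite, simple, connected graph of maximum degree $\Delta\ge 1$ whose adjacency matrix $\mathbf A_G$ has spectral radius $\rho_G\ge 1$ (the spectral radius $\rho(M)$ of a matrix is the largest modulus of its complex eigenvalues). Let $\beta,\gamma,\lambda\in\mathbb R$ with $0\le\beta\le\gamma$, $\gamma>0$, $\lambda>0$, and let $\mu_G$ be the Gibbs distribution on $\{\pm1\}^V$ with $$\mu_G(\sigma)\propto \lambda^{\#\{v:\sigma(v)=1\}}\;\beta^{\#\{\text{edges with both ends }1\}}\;\gamma^{\#\{\text{edges with both ends }-1\}} .$$ For $\Lambda\subseteq V$ and $\tau\in\{\pm1\}^\Lambda$ the influence matrix $\mathcal I^{\Lambda,\tau}_G$ is indexed by $V\setminus\Lambda$ and has entries $$\mathcal I^{\Lambda,\tau}_G(w,u)=\mu_G(\sigma(u)=1\mid \sigma|_\Lambda=\tau,\ \sigma(w)=1)-\mu_G(\sigma(u)=1\mid \sigma|_\Lambda=\tau,\ \sigma(w)=-1),$$ where the entry is $0$ if one of the two conditioning events has probability $0$. **Potential functions.** For $d\ge 1$ and $x\in\mathbb R^d$ let $$H_d(x)=\log\lambda+\sum_{i=1}^d\log\frac{\beta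 e^{x_i}+1}{e^{x_i}+\gamma},\qquad h(t)=-\frac{(1-\beta\gamma)e^t}{(\beta e^t+1)(e^t+\gamma)}\quad(t\in\mathbb R).$$ For $0\le d\le\Delta$ let $J_d\subseteq\mathbb R$ be the set of real numbers in $[\log(\lambda\beta^d),\log(\lambda/\gamma^d)]$ if $\beta\gamma\le1$, and in $[\log(\lambda/\gamma^d),\log(\lambda\beta^d)]$ if $\beta\gamma>1$ (with $\log 0=-\infty$ and $\beta^0=1$), and let $J=\bigcup_{0\le d\le\Delta}J_d$. Let $s\in[1,\infty]$, with $1/\infty=0$, and $\delta,c>0$. An $(s,\delta,c)$-potential function with respect to $(\beta,\gamma,\lambda)$ is a differentiable function $\Psi:\mathbb R\to\mathbb R$ with derivative $\chi=\Psi'>0$ everywhere such that * (contraction) for all $1\le d\le\Delta$, $y\in\mathbb R^d$ and $m\in\mathbb R_{\ge0}^d$: $\displaystyle \chi(H_d(y))\sum_{j=1}^d\frac{|h(y_j)|}{\chi(y_j)}\,m_j\le\delta^{1/s}\,\|m\|_s$; * (boundedness) for all $z_1,z_2\in J$: $\displaystyle \chi(z_1)\,\frac{|h(z_2)|}{\chi(z_2)}\le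 c$. **Theorem.** Let $\varepsilon\in(0,1)$, $\zeta>0$ and $s\in[1,\infty]$, and suppose that there is an $(s,\delta,c)$-potential function with respect to $(\beta,\gamma,\lambda)$ for $\delta=\frac{1-\varepsilon}{\rho_G}$ and $c=\frac{\zeta}{\rho_G}$. Then, for all $\Lambda\subseteq V$ and all $\tau\in\{\pm1\}^\Lambda$, $$\rho\big(\mathcal I^{\Lambda,\tau}_G\big)\le 1+\zeta\,\big(1-(1-\varepsilon)^{1/s}\big)^{-1}\Big(\frac{\Delta}{\rho_G}\Big)^{1-1/s},$$ where for $s=\infty$ the right-hand side is read as $+\infty$. -/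

import Mathlib

open scoped ENNReal

noncomputable section

namespace TwoSpin

/-! Two-spin Gibbs distributions. Spins are encoded by `Bool`: `true` is the spin `+1`
and `false` is the spin `-1`. -/

section Gibbs

variable {V : Type*} [Fintype V] [DecidableEq V]

/-- The unnormalised weight of a configuration: `lam` to the number of vertices with spin `+1`,
times `β` to the number of edges with both ends `+1`,
times `γ` to the number of edges with both ends `-1`. -/
def weight (G : SimpleGraph V) [DecidableRel G.Adj] (β γ lam : ℝ) (σ : V → Bool) : ℝ :=
  lam ^ (Finset.univ.filter fun v => σ v = true).card
    * β ^ (G.edgeFinset.filter fun e => ∀ v, v ∈ e → σ v = true).card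
    * γ ^ (G.edgeFinset.filter fun e => ∀ v, v ∈ e → σ v = false).card

/-- The Gibbs distribution: the probability of a configuration. -/
def gibbs (G : SimpleGraph V) [DecidableRel G.Adj] (β γ lam : ℝ) (σ : V → Bool) : ℝ :=
  weight G β γ lam σ / ∑ σ' : V → Bool, weight G β γ lam σ'

open Classical in
/-- The probability of a set of configurations under the Gibbs distribution. -/
def gibbsProb (G : SimpleGraph V) [DecidableRel G.Adj] (β γ lam : ℝ)
    (S : Set (V → Bool)) : ℝ :=
  ∑ σ : V → Bool, if σ ∈ S then gibbs G β γ lam σ else 0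

/-- The configurations that agree with `τ` on `Λ`. -/
def pinned (Λ : Finset V) (τ : {v // v ∈ Λ} → Bool) : Set (V → Bool) :=
  {σ | ∀ v : {v // v ∈ Λ}, σ v = τ v}

/-- The configurations that give spin `a` to the vertex `w`. -/
def spinAt (w : V) (a : Bool) : Set (V → Bool) := {σ | σ w = a}

/-- The conditional probability, given the event `S`, that `u` has spin `+1`
(meaningful when `S` has positive probability). -/
def condMarginal (G : SimpleGraph V) [DecidableRel G.Adj] (β γ lam : ℝ)
    (u : V) (S : Set (V → Bool)) : ℝ :=
  gibbsProb G β γ lam (spinAt u true ∩ S) / gibbsProb G β γ lam S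

open Classical in
/-- The pairwise influence matrix of the Gibbs distribution under the pinning `τ` of `Λ`, indexed
by the vertices outside `Λ`. The entry `(w, u)` is the difference of the conditional
probabilities that `u` has spin `+1`, given the pinning together with spin `+1`, respectively `-1`,
at `w`. If one of the two conditioning events has probability zero (which can happen only
for `β = 0`), then the difference is undefined and the entry is `0`, by the usual convention. -/
def influenceMatrix (G : SimpleGraph V) [DecidableRel G.Adj] (β γ lam : ℝ)
    (Λ : Finset V) (τ : {v // v ∈ Λ} → Bool) : Matrix {v // v ∉ Λ} {v // v ∉ Λ} ℝ :=
  fun w u =>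
    if gibbsProb G β γ lam (pinned Λ τ ∩ spinAt w true) ≠ 0 ∧
        gibbsProb G β γ lam (pinned Λ τ ∩ spinAt w false) ≠ 0 then
      condMarginal G β γ lam u (pinned Λ τ ∩ spinAt w true)
        - condMarginal G β γ lam u (pinned Λ τ ∩ spinAt w false)
    else 0

end Gibbs

/-- The spectral radius of a real square matrix: the largest modulus of its complex
eigenvalues. -/
def specRadius {n : Type*} [Fintype n] [DecidableEq n] (M : Matrix n n ℝ) : ℝ≥0∞ :=
  spectralRadius ℂ (M.map (fun x : ℝ => (x : ℂ)))

/-- The tree recursion for log-ratios of marginals at a vertex with `d` children. -/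
def treeH (β γ lam : ℝ) {d : ℕ} (x : Fin d → ℝ) : ℝ :=
  Real.log lam + ∑ i, Real.log ((β * Real.exp (x i) + 1) / (Real.exp (x i) + γ))

/-- The function `h`; `h (x i)` is the partial derivative of `treeH` in its `i`-th argument. -/
def gradH (β γ x : ℝ) : ℝ :=
  -((1 - β * γ) * Real.exp x / ((β * Real.exp x + 1) * (Real.exp x + γ)))

/-- The interval `J_d` of real log-ratios at a vertex with `d` children: it is
`[log (lam * β ^ d), log (lam / γ ^ d)]` if `β * γ ≤ 1`, with the two ends exchanged otherwise.
It is written through exponentials so that for `β = 0`, `d ≥ 1` the left end is `-∞`. -/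
def logRatioInterval (β γ lam : ℝ) (d : ℕ) : Set ℝ :=
  if β * γ ≤ 1 then {x | lam * β ^ d ≤ Real.exp x ∧ Real.exp x ≤ lam / γ ^ d}
  else {x | lam / γ ^ d ≤ Real.exp x ∧ Real.exp x ≤ lam * β ^ d}

/-- The set `J` of log-ratios at vertices with at most `Δ` children, leaves included. -/
def logRatios (Δ : ℕ) (β γ lam : ℝ) : Set ℝ :=
  ⋃ d ∈ Set.Iic Δ, logRatioInterval β γ lam d

/-- `Ψ` is an `(s, δ, c)`-potential function for `(β, γ, lam)` and trees with at most `Δ` children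
per vertex. Here `s` ranges over `[1, ∞]`, and `1 / s = 0` for `s = ∞`. A point `y` of `ℝ ^ d` is
the same as a point of the `d`-th power of the image of `Ψ`, through the inverse of `Ψ`. -/
structure IsPotential (Δ : ℕ) (β γ lam : ℝ) (s : ℝ≥0∞) (δ c : ℝ) (Ψ : ℝ → ℝ) : Prop where
  differentiable : Differentiable ℝ Ψ
  /-- `Ψ` is increasing, with a derivative by which one can divide. -/
  deriv_pos : ∀ y, 0 < deriv Ψ y
  contraction : ∀ d : ℕ, 1 ≤ d → d ≤ Δ → ∀ y m : Fin d → ℝ, (∀ j, 0 ≤ m j) →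
    deriv Ψ (treeH β γ lam y) * ∑ j, |gradH β γ (y j)| / deriv Ψ (y j) * m j
      ≤ δ ^ (s⁻¹).toReal * ‖(WithLp.toLp s m : PiLp s fun _ : Fin d => ℝ)‖
  boundedness : ∀ z₁ ∈ logRatios Δ β γ lam, ∀ z₂ ∈ logRatios Δ β γ lam,
    deriv Ψ z₁ * (|gradH β γ z₂| / deriv Ψ z₂) ≤ c

end TwoSpin

end

/-! For finite `s` it suffices to bound the weighted row sums `∑ u, |I(w, u)| θ u` by `B * θ w` for
some positive `θ` (`specRadius_le_of_row_sum_le`). The weights are `θ = f ^ (1/s)`, where `f` is the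
Perron eigenvector of the graph.

Influences are computed by Weitz's tree recursion, without building the self-avoiding walk tree. The
model is generalised to vertex-dependent activities, so that fixing a spin amounts to deleting edges
and rescaling activities. Fixing `w` to `+1` scales the activities of its neighbours by `β`, fixing
it to `-1` scales them by `γ⁻¹`. Passing between the two one neighbour at a time turns the ratio at
`w` into a product over the neighbours, and the influence of `w` into a sum (`exists_recursion`).
`Admissible` is the invariant that keeps all log-ratios in `J`.

Let `χ` be the derivative of the potential, and multiply the row sum at a vertex by `χ` at its
log-ratio. Contraction is applied to these products. Since `θ ^ s = f`, and the entries of `f` over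
the children of `w` sum to at most `ρ * f w`, one level of the recursion costs the factor `q = (1 -
ε) ^ (1/s)`; the levels add up to `1 / (1 - q)` (`deriv_mul_rowSum_le`). At the root, boundedness
replaces contraction and removes `χ` (`rowSum_le`). The remaining sum of `θ` over the neighbours of
the root is bounded by the power mean inequality, which gives the power of `Δ / ρ`.

Contraction is assumed only for finite log-ratios, whereas fixed spins correspond to infinite ones.
The limit needs no continuity of `χ`: derivatives have the intermediate value property
(`contraction_pinned`). -/

noncomputable section
set_option linter.unusedSectionVars false
namespace TwoSpin
-- Two-spin models with vertex activities, and conditioning on one spin.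
section Model
variable {V : Type*} [Fintype V] [DecidableEq V]

/-- The interaction weight of an edge. -/
def edgeWeight (β γ : ℝ) (σ : V → Bool) (e : Sym2 V) : ℝ :=
  (if ∀ v, v ∈ e → σ v = true then β else 1) * (if ∀ v, v ∈ e → σ v = false then γ else 1)

/-- The weight of a configuration in the two-spin model with edge set `E` and activities `a`. -/
def modelWeight (β γ : ℝ) (E : Finset (Sym2 V)) (a : V → ℝ) (σ : V → Bool) : ℝ :=
  (∏ v, if σ v = true then a v else 1) * ∏ e ∈ E, edgeWeight β γ σ e

/-- The unnormalised expectation of `g`. -/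
def modelSum (β γ : ℝ) (E : Finset (Sym2 V)) (a : V → ℝ) (g : (V → Bool) → ℝ) : ℝ :=
  ∑ σ : V → Bool, modelWeight β γ E a σ * g σ

/-- The indicator of the event that `w` has spin `b`. -/
def spinInd (w : V) (b : Bool) (σ : V → Bool) : ℝ := if σ w = b then 1 else 0

/-- The edges of `E` that do not contain `w`. -/
def removeVertex (E : Finset (Sym2 V)) (w : V) : Finset (Sym2 V) := E.filter (w ∉ ·)

/-- The neighbours of `w` with respect to the edge set `E`. -/
def nbrs (E : Finset (Sym2 V)) (w : V) : Finset V := Finset.univ.filter fun v => s(w, v) ∈ E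

/-- The activities `a`, multiplied by `c` on the set `N`. -/
def scaleOn (a : V → ℝ) (N : Finset V) (c : ℝ) : V → ℝ := fun v => if v ∈ N then c * a v else a v

variable {β γ : ℝ} {E : Finset (Sym2 V)} {a : V → ℝ}

lemma mem_removeVertex {w : V} {e : Sym2 V} : e ∈ removeVertex E w ↔ e ∈ E ∧ w ∉ e := by
  simp [removeVertex]

lemma mem_nbrs {w v : V} : v ∈ nbrs E w ↔ s(w, v) ∈ E := by simp [nbrs]

lemma weight_eq_modelWeight (G : SimpleGraph V) [DecidableRel G.Adj] (lam : ℝ) (σ : V → Bool) :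
    weight G β γ lam σ = modelWeight β γ G.edgeFinset (fun _ => lam) σ := by
  simp only [weight, modelWeight, edgeWeight, Finset.prod_mul_distrib, Finset.prod_ite,
    Finset.prod_const, one_pow, mul_one, mul_assoc]

lemma prod_scaleOn (a : V → ℝ) (N : Finset V) (c : ℝ) (σ : V → Bool) :
    (∏ v, if σ v = true then scaleOn a N c v else 1)
      = (∏ v, if σ v = true then a v else 1) * ∏ v ∈ N, if σ v = true then c else 1 := by
  rw [← Finset.prod_filter_mul_prod_filter_not Finset.univ (· ∈ N)
      (fun v => if σ v = true then scaleOn a N c v else 1),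
    ← Finset.prod_filter_mul_prod_filter_not Finset.univ (· ∈ N)
      (fun v => if σ v = true then a v else 1), mul_right_comm]
  congr 1
  · rw [Finset.filter_mem_eq_inter, Finset.univ_inter, ← Finset.prod_mul_distrib]
    refine Finset.prod_congr rfl fun v hv => ?_
    split_ifs <;> simp [scaleOn, hv, mul_comm]
  · refine Finset.prod_congr rfl fun v hv => ?_
    simp [scaleOn, (Finset.mem_filter.1 hv).2]

lemma edgeWeight_mk (σ : V → Bool) (w v : V) :
    edgeWeight β γ σ s(w, v) = if σ w = true then (if σ v = true then β else 1)
      else (if σ v = true then 1 else γ) := by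
  cases h1 : σ w <;> cases h2 : σ v <;> simp [edgeWeight, h1, h2]

lemma prod_edgeWeight_split (E : Finset (Sym2 V)) (w : V) (σ : V → Bool) :
    ∏ e ∈ E, edgeWeight β γ σ e
      = (∏ e ∈ removeVertex E w, edgeWeight β γ σ e) *
        ∏ v ∈ nbrs E w, edgeWeight β γ σ s(w, v) := by
  have h : E.filter (fun e => ¬ (w ∉ e)) = (nbrs E w).image fun v => s(w, v) := by
    ext e
    simp only [Finset.mem_filter, not_not, Finset.mem_image, mem_nbrs]
    constructor
    · rintro ⟨he, v, rfl⟩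
      exact ⟨v, he, rfl⟩
    · rintro ⟨v, hv, rfl⟩
      exact ⟨hv, by simp⟩
  rw [← Finset.prod_filter_mul_prod_filter_not E (w ∉ ·), h, Finset.prod_image]
  · rfl
  · intro x _ y _ hxy
    rcases Sym2.eq_iff.1 hxy with h | h
    · exact h.2
    · exact h.2.trans h.1

/-- A `+1` at `w` contributes `β` for each neighbour with spin `+1` and nothing otherwise, so its
edges can be absorbed into the activities. -/
lemma modelWeight_of_true {w : V} {σ : V → Bool} (h : σ w = true) :
    modelWeight β γ E a σ = modelWeight β γ (removeVertex E w) (scaleOn a (nbrs E w) β) σ := by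
  simp only [modelWeight, prod_scaleOn, prod_edgeWeight_split E w, edgeWeight_mk, h, if_true]
  ring

/-- A `-1` at `w` contributes `γ` for each neighbour with spin `-1`. Extracting `γ` for every
neighbour leaves `γ⁻¹` for those with spin `+1`, again an activity. -/
lemma modelWeight_of_false (hγ : 0 < γ) {w : V} {σ : V → Bool} (h : σ w = false) :
    modelWeight β γ E a σ = γ ^ (nbrs E w).card *
      modelWeight β γ (removeVertex E w) (scaleOn a (nbrs E w) γ⁻¹) σ := by
  have key : (∏ v ∈ nbrs E w, if σ v = true then (1 : ℝ) else γ)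
      = γ ^ (nbrs E w).card * ∏ v ∈ nbrs E w, if σ v = true then γ⁻¹ else 1 := by
    rw [← Finset.prod_const, ← Finset.prod_mul_distrib]
    refine Finset.prod_congr rfl fun v _ => ?_
    split_ifs <;> simp [hγ.ne']
  simp only [modelWeight, prod_scaleOn, prod_edgeWeight_split E w, edgeWeight_mk, h,
    Bool.false_eq_true, if_false, key]
  ring

lemma spinInd_add (w : V) (σ : V → Bool) : spinInd w true σ + spinInd w false σ = 1 := by
  cases h : σ w <;> simp [spinInd, h]

lemma modelSum_add (g g' : (V → Bool) → ℝ) :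
    modelSum β γ E a (fun σ => g σ + g' σ) = modelSum β γ E a g + modelSum β γ E a g' := by
  simp [modelSum, mul_add, Finset.sum_add_distrib]

lemma modelSum_split (w : V) (g : (V → Bool) → ℝ) :
    modelSum β γ E a g = modelSum β γ E a (fun σ => spinInd w true σ * g σ)
      + modelSum β γ E a (fun σ => spinInd w false σ * g σ) := by
  rw [← modelSum_add]
  congr 1
  ext σ
  rw [← add_mul, spinInd_add, one_mul]

/-- The involution that flips the spin at `w` preserves all edge weights and changes only the
activity factor at `w`. -/
lemma modelSum_flip {w : V} (hE : ∀ e ∈ E, w ∉ e) {g : (V → Bool) → ℝ}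
    (hg : ∀ σ b, g (Function.update σ w b) = g σ) :
    modelSum β γ E a (fun σ => spinInd w true σ * g σ)
      = a w * modelSum β γ E a (fun σ => spinInd w false σ * g σ) := by
  let flip : (V → Bool) → (V → Bool) := fun σ => Function.update σ w (!σ w)
  have hflip : Function.Involutive flip := by
    intro σ
    simp [flip]
  have hedge : ∀ σ, ∏ e ∈ E, edgeWeight β γ (flip σ) e = ∏ e ∈ E, edgeWeight β γ σ e := by
    intro σ
    refine Finset.prod_congr rfl fun e he => ?_
    have : ∀ v ∈ e, flip σ v = σ v := fun v hv =>
      Function.update_of_ne (by rintro rfl; exact hE e he hv) _ _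
    simp only [edgeWeight]
    congr 1 <;> refine if_congr (forall₂_congr fun v hv => by rw [this v hv]) rfl rfl
  unfold modelSum
  rw [← Equiv.sum_comp hflip.toPerm, Finset.mul_sum]
  refine Finset.sum_congr rfl fun σ _ => ?_
  change modelWeight β γ E a (flip σ) * (spinInd w true (flip σ) * g (flip σ)) = _
  rw [show g (flip σ) = g σ from hg _ _]
  cases h : σ w
  · have h1 : (∏ v, if flip σ v = true then a v else 1)
        = a w * ∏ v, if σ v = true then a v else 1 := by
      rw [← Finset.mul_prod_erase _ _ (Finset.mem_univ w),
        ← Finset.mul_prod_erase _ (fun v => if σ v = true then a v else 1) (Finset.mem_univ w)]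
      have : ∀ v ∈ Finset.univ.erase w, (if flip σ v = true then a v else 1)
          = if σ v = true then a v else 1 := by
        intro v hv
        rw [show flip σ v = σ v from Function.update_of_ne (Finset.ne_of_mem_erase hv) _ _]
      rw [Finset.prod_congr rfl this]
      simp [flip, h]
    simp only [modelWeight, hedge, h1, spinInd]
    simp [flip, h]
    ring
  · simp [spinInd, flip, h]

lemma modelSum_eq_of_isolated {w : V} (hE : ∀ e ∈ E, w ∉ e) {g : (V → Bool) → ℝ}
    (hg : ∀ σ b, g (Function.update σ w b) = g σ) :
    modelSum β γ E a g = (1 + a w) * modelSum β γ E a (fun σ => spinInd w false σ * g σ) := by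
  rw [modelSum_split w, modelSum_flip hE hg]
  ring

lemma notMem_nbrs_self {w : V} (hE : ∀ e ∈ E, ¬ e.IsDiag) : w ∉ nbrs E w := fun h =>
  hE _ (mem_nbrs.1 h) rfl

lemma scaleOn_of_notMem {N : Finset V} {c : ℝ} {v : V} (h : v ∉ N) : scaleOn a N c v = a v :=
  if_neg h

lemma scaleOn_of_mem {N : Finset V} {c : ℝ} {v : V} (h : v ∈ N) : scaleOn a N c v = c * a v :=
  if_pos h

/-- Conditioning on spin `+1` at `w`. -/
lemma modelSum_cond_true {w : V} (hE : ∀ e ∈ E, ¬ e.IsDiag) {g : (V → Bool) → ℝ}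
    (hg : ∀ σ b, g (Function.update σ w b) = g σ) :
    (1 + a w) * modelSum β γ E a (fun σ => spinInd w true σ * g σ)
      = a w * modelSum β γ (removeVertex E w) (scaleOn a (nbrs E w) β) g := by
  have h1 : modelSum β γ E a (fun σ => spinInd w true σ * g σ)
      = modelSum β γ (removeVertex E w) (scaleOn a (nbrs E w) β)
        (fun σ => spinInd w true σ * g σ) := by
    refine Finset.sum_congr rfl fun σ _ => ?_
    cases h : σ w
    · simp [spinInd, h]
    · rw [modelWeight_of_true h]
  -- The vertex `w` stays in the smaller model as an isolated vertex. Its free spin accounts for the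
  -- factor `1 + a w`.
  have h2 : ∀ e ∈ removeVertex E w, w ∉ e := fun e he => (mem_removeVertex.1 he).2
  rw [modelSum_eq_of_isolated h2 hg, h1, modelSum_flip h2 hg,
    scaleOn_of_notMem (notMem_nbrs_self hE)]
  ring

/-- Conditioning on spin `-1` at `w`. -/
lemma modelSum_cond_false (hγ : 0 < γ) {w : V} (hE : ∀ e ∈ E, ¬ e.IsDiag) {g : (V → Bool) → ℝ}
    (hg : ∀ σ b, g (Function.update σ w b) = g σ) :
    (1 + a w) * modelSum β γ E a (fun σ => spinInd w false σ * g σ)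
      = γ ^ (nbrs E w).card *
        modelSum β γ (removeVertex E w) (scaleOn a (nbrs E w) γ⁻¹) g := by
  have h1 : modelSum β γ E a (fun σ => spinInd w false σ * g σ)
      = γ ^ (nbrs E w).card * modelSum β γ (removeVertex E w) (scaleOn a (nbrs E w) γ⁻¹)
        (fun σ => spinInd w false σ * g σ) := by
    unfold modelSum
    rw [Finset.mul_sum]
    refine Finset.sum_congr rfl fun σ _ => ?_
    cases h : σ w
    · rw [modelWeight_of_false hγ h]
      ring
    · simp [spinInd, h]
  have h2 : ∀ e ∈ removeVertex E w, w ∉ e := fun e he => (mem_removeVertex.1 he).2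
  rw [modelSum_eq_of_isolated h2 hg, h1, scaleOn_of_notMem (notMem_nbrs_self hE)]
  ring

lemma modelWeight_nonneg (hβ : 0 ≤ β) (hγ : 0 < γ) (ha : ∀ v, 0 ≤ a v) (σ : V → Bool) :
    0 ≤ modelWeight β γ E a σ := by
  refine mul_nonneg (Finset.prod_nonneg fun v _ => ?_) (Finset.prod_nonneg fun e _ => ?_)
  · split_ifs
    exacts [ha v, zero_le_one]
  · unfold edgeWeight
    split_ifs <;> positivity

lemma modelSum_mono (hβ : 0 ≤ β) (hγ : 0 < γ) (ha : ∀ v, 0 ≤ a v) {g g' : (V → Bool) → ℝ}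
    (h : ∀ σ, g σ ≤ g' σ) : modelSum β γ E a g ≤ modelSum β γ E a g' :=
  Finset.sum_le_sum fun σ _ => mul_le_mul_of_nonneg_left (h σ) (modelWeight_nonneg hβ hγ ha σ)

lemma modelSum_nonneg (hβ : 0 ≤ β) (hγ : 0 < γ) (ha : ∀ v, 0 ≤ a v) {g : (V → Bool) → ℝ}
    (h : ∀ σ, 0 ≤ g σ) : 0 ≤ modelSum β γ E a g :=
  Finset.sum_nonneg fun σ _ => mul_nonneg (modelWeight_nonneg hβ hγ ha σ) (h σ)

lemma spinInd_nonneg (w : V) (b : Bool) (σ : V → Bool) : 0 ≤ spinInd w b σ := by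
  unfold spinInd
  split_ifs <;> norm_num

lemma spinInd_le_one (w : V) (b : Bool) (σ : V → Bool) : spinInd w b σ ≤ 1 := by
  unfold spinInd
  split_ifs <;> norm_num

/-- The configuration that is `-1` everywhere has positive weight. -/
lemma modelSum_pos (hβ : 0 ≤ β) (hγ : 0 < γ) (ha : ∀ v, 0 ≤ a v) {g : (V → Bool) → ℝ}
    (h : ∀ σ, 0 ≤ g σ) (h0 : 0 < g fun _ => false) : 0 < modelSum β γ E a g := by
  refine Finset.sum_pos' (fun σ _ => mul_nonneg (modelWeight_nonneg hβ hγ ha σ) (h σ))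
    ⟨fun _ => false, Finset.mem_univ _, mul_pos (mul_pos (by simp) ?_) h0⟩
  refine Finset.prod_pos fun e _ => ?_
  induction e using Sym2.ind with
  | _ x y => simp [edgeWeight_mk, hγ]

/-! ### Spin ratios, influences and the tree recursion. -/

/-- The ratio of the probabilities of the two spins at `w`. -/
def spinRatio (β γ : ℝ) (E : Finset (Sym2 V)) (a : V → ℝ) (w : V) : ℝ :=
  modelSum β γ E a (spinInd w true) / modelSum β γ E a (spinInd w false)

/-- The probability of spin `+1` at `u`. -/
def marginal (β γ : ℝ) (E : Finset (Sym2 V)) (a : V → ℝ) (u : V) : ℝ :=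
  modelSum β γ E a (spinInd u true) / modelSum β γ E a fun _ => 1

/-- The influence of `w` on `u`. -/
def influence (β γ : ℝ) (E : Finset (Sym2 V)) (a : V → ℝ) (w u : V) : ℝ :=
  modelSum β γ E a (fun σ => spinInd w true σ * spinInd u true σ)
      / modelSum β γ E a (spinInd w true)
    - modelSum β γ E a (fun σ => spinInd w false σ * spinInd u true σ)
      / modelSum β γ E a (spinInd w false)

/-- The factor that a neighbour with ratio `R` contributes to the ratio of its parent. -/
def edgeFactor (β γ R : ℝ) : ℝ := (β * R + 1) / (R + γ)

/-- The influence of a vertex on a child with ratio `R` in a tree. -/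
def edgeInfluence (β γ R : ℝ) : ℝ := (β * γ - 1) * R / ((β * R + 1) * (R + γ))

lemma spinRatio_nonneg (hβ : 0 ≤ β) (hγ : 0 < γ) (ha : ∀ v, 0 ≤ a v) (w : V) :
    0 ≤ spinRatio β γ E a w :=
  div_nonneg (modelSum_nonneg hβ hγ ha (spinInd_nonneg _ _))
    (modelSum_nonneg hβ hγ ha (spinInd_nonneg _ _))

lemma modelSum_spinInd_false_pos (hβ : 0 ≤ β) (hγ : 0 < γ) (ha : ∀ v, 0 ≤ a v) (w : V) :
    0 < modelSum β γ E a (spinInd w false) :=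
  modelSum_pos hβ hγ ha (spinInd_nonneg _ _) (by simp [spinInd])

lemma modelSum_one_pos (hβ : 0 ≤ β) (hγ : 0 < γ) (ha : ∀ v, 0 ≤ a v) :
    0 < modelSum β γ E a fun _ => 1 :=
  modelSum_pos hβ hγ ha (fun _ => zero_le_one) zero_lt_one

lemma modelSum_scaleOn_singleton (j : V) (c : ℝ) (g : (V → Bool) → ℝ) :
    modelSum β γ E (scaleOn a {j} c) g = c * modelSum β γ E a (fun σ => spinInd j true σ * g σ)
      + modelSum β γ E a (fun σ => spinInd j false σ * g σ) := by
  simp only [modelSum, modelWeight, prod_scaleOn, Finset.prod_singleton, Finset.mul_sum]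
  rw [← Finset.sum_add_distrib]
  refine Finset.sum_congr rfl fun σ _ => ?_
  cases h : σ j
  · simp [spinInd, h]
  · simp [spinInd, h]
    ring

lemma modelSum_scaleOn_singleton_one (j : V) (c : ℝ) :
    modelSum β γ E (scaleOn a {j} c) (fun _ => 1) = c * modelSum β γ E a (spinInd j true)
      + modelSum β γ E a (spinInd j false) := by
  simp [modelSum_scaleOn_singleton]

lemma scaleOn_nonneg (ha : ∀ v, 0 ≤ a v) {N : Finset V} {c : ℝ} (hc : 0 ≤ c) (v : V) :
    0 ≤ scaleOn a N c v := by
  unfold scaleOn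
  split_ifs
  exacts [mul_nonneg hc (ha v), ha v]

lemma scaleOn_insert {j : V} {N : Finset V} (hj : j ∉ N) (c : ℝ) :
    scaleOn a (insert j N) c = scaleOn (scaleOn a {j} c) N c := by
  ext v
  by_cases h : v = j
  · subst h; simp [scaleOn, hj]
  · simp [scaleOn, h]

lemma scaleOn_comm {j : V} {N : Finset V} (hj : j ∉ N) (c d : ℝ) :
    scaleOn (scaleOn a {j} c) N d = scaleOn (scaleOn a N d) {j} c := by
  ext v
  by_cases h : v = j
  · subst h; simp [scaleOn, hj]
  · simp [scaleOn, h]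

/-- If `A` and `B` are the total weights of the two spins at `j`, the quotient is `(β A + B) / (γ⁻¹
A + B)`; divide by `B`. -/
lemma partition_ratio_singleton (hβ : 0 ≤ β) (hγ : 0 < γ) (ha : ∀ v, 0 ≤ a v) (j : V) :
    (modelSum β γ E (scaleOn a {j} β) fun _ => 1) / (modelSum β γ E (scaleOn a {j} γ⁻¹) fun _ => 1)
      = γ * edgeFactor β γ (spinRatio β γ E a j) := by
  have hB := modelSum_spinInd_false_pos (E := E) hβ hγ ha j
  have hA : 0 ≤ modelSum β γ E a (spinInd j true) := modelSum_nonneg hβ hγ ha (spinInd_nonneg _ _)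
  rw [modelSum_scaleOn_singleton_one, modelSum_scaleOn_singleton_one, edgeFactor, spinRatio]
  generalize modelSum β γ E a (spinInd j true) = A at *
  generalize modelSum β γ E a (spinInd j false) = B at *
  have : A + γ * B ≠ 0 := by positivity
  have : γ⁻¹ * A + B ≠ 0 := by positivity
  have : A / B + γ ≠ 0 := by positivity
  field_simp

/-- Rescaling the activity at `j` only reweights the two conditional distributions given the spin at
`j`. So the marginal at `u` changes by the influence of `j` times the change in the probability of
`+1` at `j`, which is `β R / (β R + 1) - R / (R + γ)`. -/
lemma marginal_sub_singleton (hβ : 0 ≤ β) (hγ : 0 < γ) (ha : ∀ v, 0 ≤ a v) (j u : V) :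
    marginal β γ E (scaleOn a {j} β) u - marginal β γ E (scaleOn a {j} γ⁻¹) u
      = edgeInfluence β γ (spinRatio β γ E a j) * influence β γ E a j u := by
  have hB := modelSum_spinInd_false_pos (E := E) hβ hγ ha j
  have hA : 0 ≤ modelSum β γ E a (spinInd j true) := modelSum_nonneg hβ hγ ha (spinInd_nonneg _ _)
  have hAu : 0 ≤ modelSum β γ E a (fun σ => spinInd j true σ * spinInd u true σ) :=
    modelSum_nonneg hβ hγ ha fun σ => mul_nonneg (spinInd_nonneg _ _ _) (spinInd_nonneg _ _ _)
  have hAu' : modelSum β γ E a (fun σ => spinInd j true σ * spinInd u true σ)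
      ≤ modelSum β γ E a (spinInd j true) := modelSum_mono hβ hγ ha fun σ =>
    mul_le_of_le_one_right (spinInd_nonneg _ _ _) (spinInd_le_one _ _ _)
  rw [marginal, marginal, modelSum_scaleOn_singleton_one, modelSum_scaleOn_singleton_one,
    modelSum_scaleOn_singleton, modelSum_scaleOn_singleton, edgeInfluence, influence, spinRatio]
  generalize modelSum β γ E a (fun σ => spinInd j true σ * spinInd u true σ) = Au at *
  generalize modelSum β γ E a (fun σ => spinInd j false σ * spinInd u true σ) = Bu at *
  generalize modelSum β γ E a (spinInd j true) = A at *
  generalize modelSum β γ E a (spinInd j false) = B at *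
  -- If `j` cannot have spin `+1`, its influence involves a division by zero, but the coefficient
  -- `edgeInfluence` vanishes.
  rcases hA.eq_or_lt with rfl | hA
  · obtain rfl : Au = 0 := le_antisymm hAu' hAu
    simp
  · have : A + γ * B ≠ 0 := by positivity
    have : β * A + B ≠ 0 := by positivity
    have : γ⁻¹ * A + B ≠ 0 := by positivity
    have : A / B + γ ≠ 0 := by positivity
    have : β * (A / B) + 1 ≠ 0 := by positivity
    field_simp
    ring

/-- Changing the activities at the vertices of `N` one at a time. -/
lemma exists_telescoping (hβ : 0 ≤ β) (hγ : 0 < γ) (N : Finset V) (a : V → ℝ)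
    (ha : ∀ v, 0 ≤ a v) : ∃ b : V → V → ℝ,
      (∀ j ∈ N, ∀ v, b j v = a v ∨ v ∈ N ∧ v ≠ j ∧ (b j v = β * a v ∨ b j v = γ⁻¹ * a v)) ∧
      (modelSum β γ E (scaleOn a N β) fun _ => 1) / (modelSum β γ E (scaleOn a N γ⁻¹) fun _ => 1)
        = ∏ j ∈ N, γ * edgeFactor β γ (spinRatio β γ E (b j) j) ∧
      ∀ u, marginal β γ E (scaleOn a N β) u - marginal β γ E (scaleOn a N γ⁻¹) u
        = ∑ j ∈ N, edgeInfluence β γ (spinRatio β γ E (b j) j) * influence β γ E (b j) j u := by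
  induction N using Finset.induction_on generalizing a with
  | empty =>
    have h := modelSum_one_pos (E := E) hβ hγ ha
    have h0 : ∀ c, scaleOn a ∅ c = a := fun c => by ext; simp [scaleOn]
    exact ⟨fun _ => a, by simp, by simp [h0, h.ne'], by simp [h0]⟩
  | insert j N hj ih =>
    obtain ⟨b, hb, hZ, hm⟩ := ih (scaleOn a {j} β) (scaleOn_nonneg ha hβ)
    have hγ' : 0 ≤ γ⁻¹ := inv_nonneg.2 hγ.le
    have ha' := scaleOn_nonneg (N := N) ha hγ'
    have hne : ∀ i ∈ N, i ≠ j := fun i hi h => hj (h ▸ hi)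
    -- The new vertex `j` is switched from `γ⁻¹` to `β` first, while all of `N` is still scaled by
    -- `γ⁻¹`. The vertices of `N` follow, with `j` already scaled by `β`.
    refine ⟨fun i => if i = j then scaleOn a N γ⁻¹ else b i, ?_, ?_, fun u => ?_⟩
    · intro i hi v
      by_cases hij : i = j
      · subst hij
        by_cases hv : v ∈ N
        · right
          exact ⟨Finset.mem_insert_of_mem hv, hne v hv, Or.inr (by simp [scaleOn, hv])⟩
        · left
          simp [scaleOn, hv]
      · have hiN : i ∈ N := (Finset.mem_insert.1 hi).resolve_left hij
        simp only [hij, if_false]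
        by_cases hv : v = j
        · subst hv
          right
          refine ⟨Finset.mem_insert_self _ _, fun h => hij h.symm, Or.inl ?_⟩
          rcases hb i hiN v with h | h
          · simpa [scaleOn] using h
          · exact absurd h.1 hj
        · have h1 : scaleOn a {j} β v = a v := scaleOn_of_notMem (by simpa using hv)
          rcases hb i hiN v with h | h
          · exact Or.inl (h.trans h1)
          · rw [h1] at h
            exact Or.inr ⟨Finset.mem_insert_of_mem h.1, h.2⟩
    · beta_reduce
      rw [Finset.prod_insert hj, if_pos rfl, ← partition_ratio_singleton hβ hγ ha',
        Finset.prod_congr rfl (fun i hi => by rw [if_neg (hne i hi)]), ← hZ,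
        scaleOn_insert hj, scaleOn_insert hj, scaleOn_comm hj β γ⁻¹, scaleOn_comm hj γ⁻¹ γ⁻¹, mul_comm,
        div_mul_div_cancel₀]
      exact (modelSum_one_pos hβ hγ (scaleOn_nonneg ha' hβ)).ne'
    · beta_reduce
      rw [Finset.sum_insert hj, if_pos rfl, ← marginal_sub_singleton hβ hγ ha',
        Finset.sum_congr rfl (fun i hi => by rw [if_neg (hne i hi)]), ← hm,
        scaleOn_insert hj, scaleOn_insert hj, scaleOn_comm hj β γ⁻¹, scaleOn_comm hj γ⁻¹ γ⁻¹]
      ring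

lemma spinInd_update_of_ne {u w : V} (h : u ≠ w) (b c : Bool) (σ : V → Bool) :
    spinInd u b (Function.update σ w c) = spinInd u b σ := by
  simp [spinInd, Function.update_of_ne h]

/-- Positivity of the ratio matters: otherwise the first quotient is `0 / 0 = 0`. -/
lemma influence_self {w : V} (h : 0 < spinRatio β γ E a w) : influence β γ E a w w = 1 := by
  have h0 : modelSum β γ E a (spinInd w true) ≠ 0 := by
    intro h0
    simp [spinRatio, h0] at h
  have h1 : (fun σ => spinInd w true σ * spinInd w true σ) = spinInd w true := by
    ext σ
    cases h : σ w <;> simp [spinInd, h]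
  have h2 : (fun σ => spinInd w false σ * spinInd w true σ) = fun _ => 0 := by
    ext σ
    cases h : σ w <;> simp [spinInd, h]
  rw [influence, h1, h2, div_self h0]
  simp [modelSum]

/-- The recursion for spin ratios and influences: the vertex `w` is removed, and the activities at
its neighbours are changed. -/
theorem exists_recursion (hβ : 0 ≤ β) (hγ : 0 < γ) (ha : ∀ v, 0 ≤ a v)
    (hE : ∀ e ∈ E, ¬ e.IsDiag) (w : V) : ∃ b : V → V → ℝ,
      (∀ j ∈ nbrs E w, ∀ v, b j v = a v ∨
        v ∈ nbrs E w ∧ v ≠ j ∧ (b j v = β * a v ∨ b j v = γ⁻¹ * a v)) ∧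
      spinRatio β γ E a w = a w *
        ∏ j ∈ nbrs E w, edgeFactor β γ (spinRatio β γ (removeVertex E w) (b j) j) ∧
      (0 < spinRatio β γ E a w → ∀ u, u ≠ w → influence β γ E a w u
        = ∑ j ∈ nbrs E w, edgeInfluence β γ (spinRatio β γ (removeVertex E w) (b j) j)
          * influence β γ (removeVertex E w) (b j) j u) := by
  -- Conditioning on the two spins at `w` gives the models on the remaining edges with activities
  -- scaled by `β` and by `γ⁻¹` on all neighbours, which are the ends of the telescoping.
  obtain ⟨b, hb, hZ, hm⟩ := exists_telescoping (E := removeVertex E w) hβ hγ (nbrs E w) a ha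
  have hp := modelSum_one_pos (E := removeVertex E w) hβ hγ
    (scaleOn_nonneg (N := nbrs E w) ha hβ)
  have hn := modelSum_one_pos (E := removeVertex E w) hβ hγ
    (scaleOn_nonneg (N := nbrs E w) ha (inv_nonneg.2 hγ.le))
  have hA := modelSum_cond_true (β := β) (γ := γ) (a := a) (w := w) hE (g := fun _ => 1)
    fun _ _ => rfl
  have hB := modelSum_cond_false (β := β) (a := a) (w := w) hγ hE (g := fun _ => 1) fun _ _ => rfl
  simp only [mul_one] at hA hB
  have haw : 0 < 1 + a w := by linarith [ha w]
  refine ⟨b, hb, ?_, fun hR u hu => ?_⟩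
  · rw [Finset.prod_mul_distrib, Finset.prod_const] at hZ
    change modelSum β γ E a (spinInd w true) / modelSum β γ E a (spinInd w false) = _
    rw [← mul_div_mul_left _ _ haw.ne']
    change (1 + a w) * modelSum β γ E a (fun σ => spinInd w true σ) /
      ((1 + a w) * modelSum β γ E a (fun σ => spinInd w false σ)) = _
    rw [hA, hB, mul_comm (γ ^ _), mul_div_assoc, ← div_div, hZ]
    field_simp
  · rw [← hm]
    have hAu := modelSum_cond_true (β := β) (γ := γ) (a := a) (w := w) hE
      (g := spinInd u true) fun _ _ => spinInd_update_of_ne hu _ _ _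
    have hBu := modelSum_cond_false (β := β) (a := a) (w := w) hγ hE
      (g := spinInd u true) fun _ _ => spinInd_update_of_ne hu _ _ _
    have haw' : a w ≠ 0 := by
      intro h
      rw [h, zero_mul, mul_eq_zero] at hA
      have : modelSum β γ E a (spinInd w true) = 0 := hA.resolve_left (by simp)
      simp [spinRatio, this] at hR
    rw [influence, ← mul_div_mul_left _ (modelSum β γ E a (spinInd w true)) haw.ne',
      ← mul_div_mul_left _ (modelSum β γ E a (spinInd w false)) haw.ne', hAu, hBu]
    change _ / ((1 + a w) * modelSum β γ E a (fun σ => spinInd w true σ)) -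
      _ / ((1 + a w) * modelSum β γ E a (fun σ => spinInd w false σ)) = _
    rw [hA, hB, mul_div_mul_left _ _ haw', mul_div_mul_left _ _ (by positivity)]
    rfl

end Model
end TwoSpin
end

noncomputable section
namespace TwoSpin
-- Ranges of log-ratios, and contraction in the presence of fixed spins.
section Potential

variable {β γ lam δ c : ℝ} {s : ℝ≥0∞} {Δ : ℕ} {Ψ : ℝ → ℝ}

/-- If a bound on a derivative holds in an open interval, then it holds at its ends. -/
lemma deriv_le_of_forall_between (hd : Differentiable ℝ Ψ) {p q B : ℝ} (hpq : p ≠ q)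
    (h : ∀ z, (p < z ∧ z < q) ∨ (q < z ∧ z < p) → deriv Ψ z ≤ B) : deriv Ψ p ≤ B := by
  by_contra! hlt
  have hD : ∀ S : Set ℝ, ∀ x ∈ S, HasDerivWithinAt Ψ (deriv Ψ x) S x :=
    fun S x _ => (hd x).hasDerivAt.hasDerivWithinAt
  rcases hpq.lt_or_gt with hlt' | hlt'
  -- Darboux: if `deriv Ψ p` exceeded `B`, the derivative would take the value halfway between them
  -- at an inner point.
  · have hm := h ((p + q) / 2) (Or.inl ⟨by linarith, by linarith⟩)
    obtain ⟨z, hz, hzeq⟩ := exists_hasDerivWithinAt_eq_of_lt_of_gt (f := Ψ) (f' := deriv Ψ)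
      (a := p) (b := (p + q) / 2) (m := (B + deriv Ψ p) / 2) (by linarith) (hD _) (by linarith)
      (by linarith)
    have := h z (Or.inl ⟨hz.1, by linarith [hz.2]⟩)
    linarith
  · have hm := h ((p + q) / 2) (Or.inr ⟨by linarith, by linarith⟩)
    obtain ⟨z, hz, hzeq⟩ := exists_hasDerivWithinAt_eq_of_gt_of_lt (f := Ψ) (f' := deriv Ψ)
      (a := (p + q) / 2) (b := p) (m := (B + deriv Ψ p) / 2) (by linarith) (hD _) (by linarith)
      (by linarith)
    have := h z (Or.inr ⟨by linarith [hz.1], hz.2⟩)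
    linarith

lemma gradH_eq_edgeInfluence (x : ℝ) : gradH β γ x = edgeInfluence β γ (Real.exp x) := by
  rw [gradH, edgeInfluence, ← neg_div]
  ring

lemma edgeFactor_pos (hβ : 0 ≤ β) (hγ : 0 < γ) {R : ℝ} (hR : 0 ≤ R) : 0 < edgeFactor β γ R := by
  unfold edgeFactor
  positivity

/-- The factor is the mean of `β` and `γ⁻¹` with weights `R` and `γ`. -/
lemma edgeFactor_mem_uIcc (hγ : 0 < γ) {R : ℝ} (hR : 0 ≤ R) :
    edgeFactor β γ R ∈ Set.uIcc β γ⁻¹ := by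
  have h : 0 < R + γ := by positivity
  have h1 : γ⁻¹ = (γ⁻¹ * R + 1) / (R + γ) := by field_simp
  have h2 : β = (β * R + β * γ) / (R + γ) := by field_simp
  unfold edgeFactor
  rcases le_total β γ⁻¹ with hle | hle
  · have h3 : β * γ ≤ 1 := by simpa [hγ.ne'] using mul_le_mul_of_nonneg_right hle hγ.le
    refine Set.Icc_subset_uIcc ⟨?_, ?_⟩
    · rw [le_div_iff₀ h]; linarith
    · rw [div_le_iff₀ h, mul_add, inv_mul_cancel₀ hγ.ne']
      linarith [mul_le_mul_of_nonneg_right hle hR]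
  · have h3 : 1 ≤ β * γ := by simpa [hγ.ne'] using mul_le_mul_of_nonneg_right hle hγ.le
    refine Set.Icc_subset_uIcc' ⟨?_, ?_⟩
    · rw [le_div_iff₀ h, mul_add, inv_mul_cancel₀ hγ.ne']
      linarith [mul_le_mul_of_nonneg_right hle hR]
    · rw [div_le_iff₀ h]; linarith

lemma mul_mem_uIcc_pow {p q : ℝ} (hp : 0 ≤ p) (hq : 0 ≤ q) {k l : ℕ} {x y : ℝ}
    (hx : x ∈ Set.uIcc (p ^ k) (q ^ k)) (hy : y ∈ Set.uIcc (p ^ l) (q ^ l)) :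
    x * y ∈ Set.uIcc (p ^ (k + l)) (q ^ (k + l)) := by
  wlog hpq : p ≤ q generalizing p q
  · rw [Set.uIcc_comm] at hx hy ⊢
    exact this hq hp hx hy (le_of_not_ge hpq)
  have hpow : ∀ n, p ^ n ≤ q ^ n := fun n => pow_le_pow_left₀ hp hpq n
  rw [Set.uIcc_of_le (hpow _)] at hx hy ⊢
  have hp' : ∀ n, 0 ≤ p ^ n := fun n => pow_nonneg hp n
  rw [pow_add, pow_add]
  exact ⟨mul_le_mul hx.1 hy.1 (hp' _) ((hp' _).trans hx.1),
    mul_le_mul hx.2 hy.2 ((hp' _).trans hy.1) (pow_nonneg hq _)⟩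

lemma prod_mem_uIcc_pow {ι : Type*} {p q : ℝ} (hp : 0 ≤ p) (hq : 0 ≤ q) (N : Finset ι)
    (x : ι → ℝ) (hx : ∀ i ∈ N, x i ∈ Set.uIcc p q) :
    ∏ i ∈ N, x i ∈ Set.uIcc (p ^ N.card) (q ^ N.card) := by
  classical
  induction N using Finset.induction_on with
  | empty => simp
  | insert i N hi ih =>
    rw [Finset.prod_insert hi, Finset.card_insert_of_notMem hi, mul_comm]
    refine mul_mem_uIcc_pow hp hq (ih fun j hj => hx j (Finset.mem_insert_of_mem hj)) ?_
    simpa using hx i (Finset.mem_insert_self _ _)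

lemma log_mem_logRatios (hγ : 0 < γ) (hlam : 0 < lam) (hβ : 0 ≤ β) {d : ℕ} (hd : d ≤ Δ) {t : ℝ}
    (ht : t ∈ Set.uIcc (β ^ d) (γ⁻¹ ^ d)) (htpos : 0 < t) :
    Real.log (lam * t) ∈ logRatios Δ β γ lam := by
  refine Set.mem_biUnion (show d ∈ Set.Iic Δ from hd) ?_
  have hexp : Real.exp (Real.log (lam * t)) = lam * t := Real.exp_log (mul_pos hlam htpos)
  have hdiv : lam / γ ^ d = lam * γ⁻¹ ^ d := by rw [inv_pow, div_eq_mul_inv]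
  unfold logRatioInterval
  split_ifs with h
  · have h' : β ≤ γ⁻¹ := by rwa [← one_div, le_div_iff₀ hγ]
    rw [Set.uIcc_of_le (pow_le_pow_left₀ hβ h' _)] at ht
    rw [Set.mem_ofPred_eq, hexp, hdiv]
    exact ⟨mul_le_mul_of_nonneg_left ht.1 hlam.le, mul_le_mul_of_nonneg_left ht.2 hlam.le⟩
  · have h' : γ⁻¹ ≤ β := by
      rw [← one_div, div_le_iff₀ hγ]
      exact (not_le.1 h).le
    rw [Set.uIcc_of_ge (pow_le_pow_left₀ (inv_nonneg.2 hγ.le) h' _)] at ht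
    rw [Set.mem_ofPred_eq, hexp, hdiv]
    exact ⟨mul_le_mul_of_nonneg_left ht.1 hlam.le, mul_le_mul_of_nonneg_left ht.2 hlam.le⟩

/-- The contraction with `K` further children, all with the same log-ratio and mass zero. -/
lemma IsPotential.contraction_finset (hΨ : IsPotential Δ β γ lam s δ c Ψ) (hs : 1 ≤ s)
    (hs' : s ≠ ⊤) {ι : Type*} (N : Finset ι) (K : ℕ) (h1 : 1 ≤ N.card) (hK : N.card + K ≤ Δ)
    (y m : ι → ℝ) (hm : ∀ i ∈ N, 0 ≤ m i) (x : ℝ) :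
    deriv Ψ (Real.log lam + ∑ i ∈ N, Real.log (edgeFactor β γ (Real.exp (y i)))
        + K * Real.log (edgeFactor β γ (Real.exp x)))
      * ∑ i ∈ N, |gradH β γ (y i)| / deriv Ψ (y i) * m i
      ≤ δ ^ (s⁻¹).toReal * (∑ i ∈ N, m i ^ s.toReal) ^ (1 / s.toReal) := by
  classical
  have hspos : 0 < s.toReal := ENNReal.toReal_pos (zero_lt_one.trans_le hs).ne' hs'
  have hcard : Fintype.card (N ⊕ Fin K) = N.card + K := by simp
  let e : Fin (N.card + K) ≃ N ⊕ Fin K := (Fintype.equivFinOfCardEq hcard).symm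
  -- The extra children shift the argument of `deriv Ψ` but, having mass zero, add nothing to the
  -- sum or the norm.
  let y' : N ⊕ Fin K → ℝ := Sum.elim (fun i => y i) fun _ => x
  let m' : N ⊕ Fin K → ℝ := Sum.elim (fun i => m i) fun _ => 0
  have hm' : ∀ i, 0 ≤ m' i := by
    rintro (i | i)
    exacts [hm _ i.2, le_rfl]
  have hsum : ∀ F : N ⊕ Fin K → ℝ, ∑ j, F (e j) = ∑ i : N, F (Sum.inl i) + ∑ i, F (Sum.inr i) :=
    fun F => by rw [Equiv.sum_comp e F, Fintype.sum_sum_type]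
  have key := hΨ.contraction (N.card + K) (by omega) hK (fun j => y' (e j)) (fun j => m' (e j))
    fun j => hm' _
  rw [PiLp.norm_eq_sum hspos] at key
  have e1 : treeH β γ lam (fun j => y' (e j))
      = Real.log lam + ∑ i ∈ N, Real.log (edgeFactor β γ (Real.exp (y i)))
        + K * Real.log (edgeFactor β γ (Real.exp x)) := by
    rw [treeH, hsum fun i => Real.log ((β * Real.exp (y' i) + 1) / (Real.exp (y' i) + γ)),
      ← Finset.sum_coe_sort N]
    simp [y', edgeFactor, add_assoc]
  have e2 : ∑ j, |gradH β γ (y' (e j))| / deriv Ψ (y' (e j)) * m' (e j)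
      = ∑ i ∈ N, |gradH β γ (y i)| / deriv Ψ (y i) * m i := by
    rw [hsum fun i => |gradH β γ (y' i)| / deriv Ψ (y' i) * m' i, ← Finset.sum_coe_sort N]
    simp [y', m']
  have e3 : ∑ j, ‖(WithLp.toLp s (fun j => m' (e j)) : PiLp s fun _ => ℝ) j‖ ^ s.toReal
      = ∑ i ∈ N, m i ^ s.toReal := by
    rw [← Finset.sum_coe_sort N]
    change ∑ j, ‖m' (e j)‖ ^ s.toReal = _
    rw [hsum fun i => ‖m' i‖ ^ s.toReal]
    simp only [m', Sum.elim_inl, Sum.elim_inr, norm_zero, Real.zero_rpow hspos.ne',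
      Finset.sum_const_zero, add_zero]
    exact Finset.sum_congr rfl fun i _ => by rw [Real.norm_of_nonneg (hm _ i.2)]
  rwa [e1, e2, e3] at key

/-- Solving `(β R + 1) / (R + γ) = r` gives `R = (1 - r γ) / (r - β)`, which is positive exactly
because `r` lies strictly between the two ends. -/
lemma exists_edgeFactor_exp_eq {r : ℝ} (hγ : 0 < γ)
    (h : (β < r ∧ r < γ⁻¹) ∨ (γ⁻¹ < r ∧ r < β)) : ∃ x, edgeFactor β γ (Real.exp x) = r := by
  have hpos : 0 < (1 - r * γ) / (r - β) := by
    rcases h with h | h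
    · have : r * γ < 1 := by simpa [hγ.ne'] using mul_lt_mul_of_pos_right h.2 hγ
      exact div_pos (by linarith) (by linarith)
    · have : 1 < r * γ := by simpa [hγ.ne'] using mul_lt_mul_of_pos_right h.1 hγ
      exact div_pos_of_neg_of_neg (by linarith) (by linarith)
  refine ⟨Real.log ((1 - r * γ) / (r - β)), ?_⟩
  rw [Real.exp_log hpos, edgeFactor, div_eq_iff (by positivity)]
  have : r - β ≠ 0 := by
    rcases h with h | h
    · exact (sub_pos.2 h.1).ne'
    · exact (sub_neg.2 h.2).ne
  field_simp
  ring

/-- The contraction with `K` further children, whose spins may be fixed. -/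
theorem IsPotential.contraction_pinned (hΨ : IsPotential Δ β γ lam s δ c Ψ) (hs : 1 ≤ s)
    (hs' : s ≠ ⊤) (hβ : 0 ≤ β) (hγ : 0 < γ) (hδ : 0 ≤ δ) {ι : Type*} (N : Finset ι) (K : ℕ)
    (h1 : 1 ≤ N.card) (hK : N.card + K ≤ Δ) (y m : ι → ℝ) (hm : ∀ i ∈ N, 0 ≤ m i) {t : ℝ}
    (ht : t ∈ Set.uIcc (β ^ K) (γ⁻¹ ^ K)) (htpos : 0 < t) :
    deriv Ψ (Real.log lam + ∑ i ∈ N, Real.log (edgeFactor β γ (Real.exp (y i))) + Real.log t)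
      * ∑ i ∈ N, |gradH β γ (y i)| / deriv Ψ (y i) * m i
      ≤ δ ^ (s⁻¹).toReal * (∑ i ∈ N, m i ^ s.toReal) ^ (1 / s.toReal) := by
  have hcon := hΨ.contraction_finset hs hs' N K h1 hK y m hm
  have hS : 0 ≤ ∑ i ∈ N, |gradH β γ (y i)| / deriv Ψ (y i) * m i :=
    Finset.sum_nonneg fun i hi =>
      mul_nonneg (div_nonneg (abs_nonneg _) (hΨ.deriv_pos _).le) (hm i hi)
  have hB : 0 ≤ δ ^ (s⁻¹).toReal * (∑ i ∈ N, m i ^ s.toReal) ^ (1 / s.toReal) :=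
    mul_nonneg (Real.rpow_nonneg hδ _) (Real.rpow_nonneg
      (Finset.sum_nonneg fun i hi => Real.rpow_nonneg (hm i hi) _) _)
  rcases Nat.eq_zero_or_pos K with rfl | hKpos
  · obtain rfl : t = 1 := by simpa using ht
    simpa using hcon 0
  rcases hS.eq_or_lt with hS0 | hSpos
  · rw [← hS0, mul_zero]
    exact hB
  -- If `β γ = 1` there is no interaction: `gradH` vanishes, and so does the sum.
  have hβγ : β ≠ γ⁻¹ := by
    rintro rfl
    refine hSpos.ne' (Finset.sum_eq_zero fun i _ => ?_)
    simp [gradH, hγ.ne']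
  generalize (∑ i ∈ N, |gradH β γ (y i)| / deriv Ψ (y i) * m i) = S at *
  generalize δ ^ (s⁻¹).toReal * (∑ i ∈ N, m i ^ s.toReal) ^ (1 / s.toReal) = B at *
  generalize (Real.log lam + ∑ i ∈ N, Real.log (edgeFactor β γ (Real.exp (y i)))) = L at *
  have hinv : 0 < γ⁻¹ := inv_pos.2 hγ
  -- For `t` strictly inside, `K` equal children, each with factor `t ^ (1/K)`, realise `t` at a
  -- finite log-ratio.
  have hint : ∀ t, 0 < t → (β ^ K < t ∧ t < γ⁻¹ ^ K) ∨ (γ⁻¹ ^ K < t ∧ t < β ^ K) →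
      deriv Ψ (L + Real.log t) * S ≤ B := by
    intro t ht0 ht
    have hr0 : 0 ≤ t ^ ((K : ℝ)⁻¹) := Real.rpow_nonneg ht0.le _
    have hr : (t ^ ((K : ℝ)⁻¹)) ^ K = t := Real.rpow_inv_natCast_pow ht0.le hKpos.ne'
    obtain ⟨x, hx⟩ := exists_edgeFactor_exp_eq (β := β) (r := t ^ ((K : ℝ)⁻¹)) hγ (by
      rw [← hr] at ht
      exact ht.imp (fun h => ⟨lt_of_pow_lt_pow_left₀ K hr0 h.1,
        lt_of_pow_lt_pow_left₀ K hinv.le h.2⟩)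
        fun h => ⟨lt_of_pow_lt_pow_left₀ K hr0 h.1, lt_of_pow_lt_pow_left₀ K hβ h.2⟩)
    have := hcon x
    rwa [hx, ← Real.log_pow, hr] at this
  have hpow : β ^ K ≠ γ⁻¹ ^ K := fun h => hβγ ((pow_left_inj₀ hβ hinv.le hKpos.ne').1 h)
  by_cases hti : (β ^ K < t ∧ t < γ⁻¹ ^ K) ∨ (γ⁻¹ ^ K < t ∧ t < β ^ K)
  · exact hint t htpos hti
  have hend : t = β ^ K ∨ t = γ⁻¹ ^ K := by
    rcases Set.mem_uIcc.1 ht with h | h <;> by_contra! hne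
    · exact hti (Or.inl ⟨lt_of_le_of_ne h.1 hne.1.symm, lt_of_le_of_ne h.2 hne.2⟩)
    · exact hti (Or.inr ⟨lt_of_le_of_ne h.1 hne.2.symm, lt_of_le_of_ne h.2 hne.1⟩)
  have hβK : 0 ≤ β ^ K := pow_nonneg hβ K
  have hγK : 0 < γ⁻¹ ^ K := pow_pos hinv K
  generalize β ^ K = p at *
  generalize γ⁻¹ ^ K = q at *
  have hu : 0 < (p + q) / 2 := by linarith
  rw [← le_div_iff₀ hSpos]
  -- At an end of the interval, the bound is carried over from the points between it and the
  -- midpoint, in the logarithmic coordinate.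
  refine deriv_le_of_forall_between (q := L + Real.log ((p + q) / 2)) hΨ.differentiable ?_ ?_
  · intro h
    have := Real.log_injOn_pos htpos hu (add_left_cancel h)
    rcases hend with rfl | rfl
    · exact hpow (by linarith)
    · exact hpow (by linarith)
  · intro z hz
    rw [le_div_iff₀ hSpos]
    have hzz : z = L + Real.log (Real.exp (z - L)) := by rw [Real.log_exp]; ring
    rw [hzz]
    refine hint _ (Real.exp_pos _) ?_
    have hz' : (t < Real.exp (z - L) ∧ Real.exp (z - L) < (p + q) / 2) ∨
        ((p + q) / 2 < Real.exp (z - L) ∧ Real.exp (z - L) < t) := by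
      rw [← Real.log_lt_iff_lt_exp htpos, ← Real.log_lt_iff_lt_exp hu, ← Real.lt_log_iff_exp_lt hu,
        ← Real.lt_log_iff_exp_lt htpos]
      exact hz.imp (fun h => ⟨by linarith [h.1], by linarith [h.2]⟩)
        fun h => ⟨by linarith [h.1], by linarith [h.2]⟩
    generalize Real.exp (z - L) = r at *
    rcases hpow.lt_or_gt with hlt | hlt <;> rcases hend with rfl | rfl <;>
      rcases hz' with h | h <;>
      first
      | exact Or.inl ⟨by linarith [h.1, h.2], by linarith [h.1, h.2]⟩
      | exact Or.inr ⟨by linarith [h.1, h.2], by linarith [h.1, h.2]⟩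

end Potential
end TwoSpin
end

noncomputable section
set_option linter.unusedSectionVars false
namespace TwoSpin
-- Weighted row sums: decay along the recursion, and the bound at the root.
section Bound
variable {V : Type*} [Fintype V] [DecidableEq V]
variable {β γ lam δ c : ℝ} {s : ℝ≥0∞} {Δ : ℕ} {Ψ : ℝ → ℝ} {E : Finset (Sym2 V)} {a : V → ℝ}

/-- The activities arise from the uniform activity `lam` by deleting, at each vertex `v`, at most
`Δ - deg v` edges to vertices whose spin is fixed. -/
def Admissible (β γ lam : ℝ) (Δ : ℕ) (E : Finset (Sym2 V)) (a : V → ℝ) : Prop :=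
  ∀ v, ∃ k t, k + (nbrs E v).card ≤ Δ ∧ t ∈ Set.uIcc (β ^ k) (γ⁻¹ ^ k) ∧ a v = lam * t

lemma nbrs_removeVertex_subset (E : Finset (Sym2 V)) (w v : V) :
    nbrs (removeVertex E w) v ⊆ nbrs E v := fun _ hu =>
  mem_nbrs.2 (mem_removeVertex.1 (mem_nbrs.1 hu)).1

lemma card_nbrs_removeVertex_lt {w v : V} (h : v ∈ nbrs E w) :
    (nbrs (removeVertex E w) v).card < (nbrs E v).card := by
  refine Finset.card_lt_card ((Finset.ssubset_iff_of_subset (nbrs_removeVertex_subset E w v)).2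
    ⟨w, ?_, fun hw => (mem_removeVertex.1 (mem_nbrs.1 hw)).2 (by simp)⟩)
  rw [mem_nbrs, Sym2.eq_swap]
  exact mem_nbrs.1 h

lemma card_removeVertex_lt {w v : V} (h : v ∈ nbrs E w) : (removeVertex E w).card < E.card :=
  Finset.card_lt_card ((Finset.ssubset_iff_of_subset (Finset.filter_subset _ _)).2
    ⟨s(w, v), mem_nbrs.1 h, fun hw => (mem_removeVertex.1 hw).2 (by simp)⟩)

lemma Admissible.nonneg (h : Admissible β γ lam Δ E a) (hβ : 0 ≤ β) (hγ : 0 < γ)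
    (hlam : 0 < lam) (v : V) : 0 ≤ a v := by
  obtain ⟨k, t, -, ht, hv⟩ := h v
  rw [hv]
  refine mul_nonneg hlam.le ?_
  rcases Set.mem_uIcc.1 ht with h | h
  · exact (pow_nonneg hβ k).trans h.1
  · exact (pow_nonneg (inv_nonneg.2 hγ.le) k).trans h.1

/-- A vertex whose activity gains a factor `β` or `γ⁻¹` is a neighbour of `w` and loses the edge to
`w`, so `k` may grow by one. -/
lemma Admissible.removeVertex (h : Admissible β γ lam Δ E a) (hβ : 0 ≤ β) (hγ : 0 < γ) {w : V}
    {b : V → ℝ}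
    (hb : ∀ v, b v = a v ∨ v ∈ nbrs E w ∧ (b v = β * a v ∨ b v = γ⁻¹ * a v)) :
    Admissible β γ lam Δ (removeVertex E w) b := by
  intro v
  obtain ⟨k, t, hk, ht, hv⟩ := h v
  have hγ' : 0 ≤ γ⁻¹ := inv_nonneg.2 hγ.le
  rcases hb v with h1 | ⟨hmem, h1⟩
  · have := Finset.card_le_card (nbrs_removeVertex_subset E w v)
    exact ⟨k, t, by omega, ht, h1.trans hv⟩
  · have := card_nbrs_removeVertex_lt hmem
    rcases h1 with h1 | h1
    · refine ⟨k + 1, t * β, by omega, mul_mem_uIcc_pow hβ hγ' ht (by simp), ?_⟩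
      rw [h1, hv]
      ring
    · refine ⟨k + 1, t * γ⁻¹, by omega, mul_mem_uIcc_pow hβ hγ' ht (by simp), ?_⟩
      rw [h1, hv]
      ring

/-- The sum of the absolute influences of `w`, with weights `θ`. -/
def rowSum (β γ : ℝ) (θ : V → ℝ) (E : Finset (Sym2 V)) (a : V → ℝ) (w : V) : ℝ :=
  ∑ u, |influence β γ E a w u| * θ u

lemma rowSum_nonneg {θ : V → ℝ} (hθ : ∀ v, 0 < θ v) (w : V) : 0 ≤ rowSum β γ θ E a w :=
  Finset.sum_nonneg fun u _ => mul_nonneg (abs_nonneg _) (hθ u).le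

/-- The recursion for weighted row sums, with the data that bound the ratio at the root. -/
theorem exists_rowSum_recursion (hβ : 0 ≤ β) (hγ : 0 < γ) (hlam : 0 < lam)
    (hE : ∀ e ∈ E, ¬ e.IsDiag) (ha : Admissible β γ lam Δ E a) {θ : V → ℝ} (hθ : ∀ v, 0 < θ v)
    (w : V) (hw : 0 < spinRatio β γ E a w) :
    ∃ (b : V → V → ℝ) (N : Finset V) (K : ℕ) (t : ℝ), N ⊆ nbrs E w ∧ N.card + K ≤ Δ ∧ 0 < t ∧
      t ∈ Set.uIcc (β ^ K) (γ⁻¹ ^ K) ∧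
      (∀ j ∈ N, Admissible β γ lam Δ (removeVertex E w) (b j)) ∧
      (∀ j ∈ N, 0 < spinRatio β γ (removeVertex E w) (b j) j) ∧
      spinRatio β γ E a w = lam * (t *
        ∏ j ∈ N, edgeFactor β γ (spinRatio β γ (removeVertex E w) (b j) j)) ∧
      rowSum β γ θ E a w ≤ θ w + ∑ j ∈ N,
        |edgeInfluence β γ (spinRatio β γ (removeVertex E w) (b j) j)|
          * rowSum β γ θ (removeVertex E w) (b j) j := by
  have ha0 := ha.nonneg hβ hγ hlam
  have hγ' : 0 ≤ γ⁻¹ := inv_nonneg.2 hγ.le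
  obtain ⟨b, hb, hR, hI⟩ := exists_recursion hβ hγ ha0 hE w
  obtain ⟨k, t, hk, ht, hv⟩ := ha w
  have hadm : ∀ j ∈ nbrs E w, Admissible β γ lam Δ (removeVertex E w) (b j) := fun j hj =>
    ha.removeVertex hβ hγ fun v => (hb j hj v).imp_right fun h => ⟨h.1, h.2.2⟩
  set R : V → ℝ := fun j => spinRatio β γ (removeVertex E w) (b j) j with hRdef
  have hR0 : ∀ j ∈ nbrs E w, 0 ≤ R j := fun j hj =>
    spinRatio_nonneg hβ hγ ((hadm j hj).nonneg hβ hγ hlam) j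
  -- Neighbours with ratio `0` have no real log-ratio. They carry no influence, so they are counted
  -- among the `K` fixed children, and their factors go into `t`.
  set N := (nbrs E w).filter fun j => 0 < R j with hN
  set N' := (nbrs E w).filter fun j => ¬ 0 < R j with hN'
  have hzero : ∀ j ∈ N', R j = 0 := fun j hj =>
    le_antisymm (not_lt.1 (Finset.mem_filter.1 hj).2) (hR0 j (Finset.mem_filter.1 hj).1)
  have hNsub : N ⊆ nbrs E w := Finset.filter_subset _ _
  have hcard : N.card + N'.card = (nbrs E w).card := Finset.card_filter_add_card_filter_not _
  have hprod : (∏ j ∈ N', edgeFactor β γ (R j)) * ∏ j ∈ N, edgeFactor β γ (R j)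
      = ∏ j ∈ nbrs E w, edgeFactor β γ (R j) := by
    rw [mul_comm]
    exact Finset.prod_filter_mul_prod_filter_not _ _ _
  have hRw : spinRatio β γ E a w = lam * ((t * ∏ j ∈ N', edgeFactor β γ (R j)) *
      ∏ j ∈ N, edgeFactor β γ (R j)) := by
    rw [hR, ← hprod, hv]
    ring
  have hpos : 0 < ∏ j ∈ N, edgeFactor β γ (R j) :=
    Finset.prod_pos fun j hj => edgeFactor_pos hβ hγ (hR0 j (hNsub hj))
  refine ⟨b, N, k + N'.card, t * ∏ j ∈ N', edgeFactor β γ (R j), hNsub, by omega, ?_, ?_,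
    fun j hj => hadm j (hNsub hj), fun j hj => (Finset.mem_filter.1 hj).2, hRw, ?_⟩
  · rw [hRw] at hw
    exact pos_of_mul_pos_left (pos_of_mul_pos_right hw hlam.le) hpos.le
  · refine mul_mem_uIcc_pow hβ hγ' ht (prod_mem_uIcc_pow hβ hγ' _ _ fun j hj => ?_)
    exact edgeFactor_mem_uIcc hγ (hR0 j (Finset.mem_filter.1 hj).1)
  · have hterm : ∀ u ∈ Finset.univ.erase w, |influence β γ E a w u| * θ u
        ≤ ∑ j ∈ N, |edgeInfluence β γ (R j)| *
          (|influence β γ (removeVertex E w) (b j) j u| * θ u) := by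
      intro u hu
      have hsum : ∑ j ∈ nbrs E w, edgeInfluence β γ (R j) *
          influence β γ (removeVertex E w) (b j) j u
          = ∑ j ∈ N, edgeInfluence β γ (R j) * influence β γ (removeVertex E w) (b j) j u := by
        refine (Finset.sum_subset hNsub fun j hj hjN => ?_).symm
        rw [hzero j (Finset.mem_filter.2 ⟨hj, fun h => hjN (Finset.mem_filter.2 ⟨hj, h⟩)⟩)]
        simp [edgeInfluence]
      rw [hI hw u (Finset.ne_of_mem_erase hu), hsum]
      calc _ ≤ (∑ j ∈ N, |edgeInfluence β γ (R j) *
              influence β γ (removeVertex E w) (b j) j u|) * θ u :=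
            mul_le_mul_of_nonneg_right (Finset.abs_sum_le_sum_abs _ _) (hθ u).le
        _ = _ := by
            rw [Finset.sum_mul]
            exact Finset.sum_congr rfl fun j _ => by rw [abs_mul, mul_assoc]
    rw [rowSum, ← Finset.add_sum_erase _ _ (Finset.mem_univ w), influence_self hw, abs_one,
      one_mul]
    refine add_le_add_right ((Finset.sum_le_sum hterm).trans ?_) _
    rw [Finset.sum_comm]
    refine Finset.sum_le_sum fun j _ => ?_
    rw [← Finset.mul_sum]
    refine mul_le_mul_of_nonneg_left ?_ (abs_nonneg _)
    exact Finset.sum_le_sum_of_subset_of_nonneg (Finset.erase_subset _ _)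
      fun u _ _ => mul_nonneg (abs_nonneg _) (hθ u).le

/-- Fixed and free children together number at most `Δ`, and each contributes a factor between `β`
and `γ⁻¹`. -/
lemma log_spinRatio_mem (hβ : 0 ≤ β) (hγ : 0 < γ) (hlam : 0 < lam) {ι : Type*} {N : Finset ι}
    {K : ℕ} {t : ℝ} {R : ι → ℝ} (hK : N.card + K ≤ Δ) (ht0 : 0 < t)
    (ht : t ∈ Set.uIcc (β ^ K) (γ⁻¹ ^ K)) (hR : ∀ j ∈ N, 0 < R j) :
    Real.log (lam * (t * ∏ j ∈ N, edgeFactor β γ (R j))) ∈ logRatios Δ β γ lam := by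
  refine log_mem_logRatios (d := K + N.card) hγ hlam hβ (by omega) ?_ ?_
  · exact mul_mem_uIcc_pow hβ (inv_nonneg.2 hγ.le) ht (prod_mem_uIcc_pow hβ (inv_nonneg.2 hγ.le)
      _ _ fun j hj => edgeFactor_mem_uIcc hγ (hR j hj).le)
  · exact mul_pos ht0 (Finset.prod_pos fun j hj => edgeFactor_pos hβ hγ (hR j hj).le)

lemma log_ratio_eq (hβ : 0 ≤ β) (hγ : 0 < γ) (hlam : 0 < lam) {ι : Type*} {N : Finset ι} {t : ℝ}
    {R : ι → ℝ} (ht0 : 0 < t) (hR : ∀ j ∈ N, 0 < R j) :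
    Real.log (lam * (t * ∏ j ∈ N, edgeFactor β γ (R j)))
      = Real.log lam + ∑ j ∈ N, Real.log (edgeFactor β γ (Real.exp (Real.log (R j))))
        + Real.log t := by
  have hne : ∀ j ∈ N, edgeFactor β γ (R j) ≠ 0 := fun j hj =>
    (edgeFactor_pos hβ hγ (hR j hj).le).ne'
  rw [Real.log_mul hlam.ne' (mul_ne_zero ht0.ne' (Finset.prod_ne_zero_iff.2 hne)),
    Real.log_mul ht0.ne' (Finset.prod_ne_zero_iff.2 hne), Real.log_prod hne,
    Finset.sum_congr rfl fun j hj => congrArg (fun x => Real.log (edgeFactor β γ x))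
      (Real.exp_log (hR j hj)).symm]
  ring

/-- The row sum below a vertex, in terms of the potential at the log-ratio of the vertex. -/
theorem deriv_mul_rowSum_le (hΨ : IsPotential Δ β γ lam s δ c Ψ) (hs : 1 ≤ s) (hs' : s ≠ ⊤)
    (hβ : 0 ≤ β) (hγ : 0 < γ) (hlam : 0 < lam) (hδ : 0 ≤ δ) {θ : V → ℝ} (hθ : ∀ v, 0 < θ v)
    {E₀ : Finset (Sym2 V)} (hE₀ : ∀ e ∈ E₀, ¬ e.IsDiag) {q : ℝ} (hq : q < 1)
    (hθq : ∀ w, ∀ N ⊆ nbrs E₀ w,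
      δ ^ (s⁻¹).toReal * (∑ j ∈ N, θ j ^ s.toReal) ^ (1 / s.toReal) ≤ q * θ w)
    {M : ℝ} (hM : ∀ z ∈ logRatios Δ β γ lam, deriv Ψ z ≤ M)
    {E : Finset (Sym2 V)} (hE : E ⊆ E₀) {a : V → ℝ} (ha : Admissible β γ lam Δ E a) (w : V)
    (hw : 0 < spinRatio β γ E a w) :
    deriv Ψ (Real.log (spinRatio β γ E a w)) * rowSum β γ θ E a w ≤ M * (1 - q)⁻¹ * θ w := by
  induction hn : E.card using Nat.strong_induction_on generalizing E a w with
  | _ n ih =>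
  subst hn
  obtain ⟨b, N, K, t, hN, hK, ht0, ht, hadm, hpos, hR, hrow⟩ :=
    exists_rowSum_recursion hβ hγ hlam (fun e he => hE₀ e (hE he)) ha hθ w hw
  have hsub : removeVertex E w ⊆ E₀ := (Finset.filter_subset _ _).trans hE
  set R : V → ℝ := fun j => spinRatio β γ (removeVertex E w) (b j) j with hRdef
  set S : V → ℝ := fun j => rowSum β γ θ (removeVertex E w) (b j) j with hSdef
  set χ := deriv Ψ (Real.log (spinRatio β γ E a w)) with hχ
  have hχpos : 0 < χ := hΨ.deriv_pos _
  have hχM : χ ≤ M := hM _ (by rw [hR]; exact log_spinRatio_mem hβ hγ hlam hK ht0 ht hpos)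
  have hM0 : 0 < M := hχpos.trans_le hχM
  have h1q : 0 < 1 - q := sub_pos.2 hq
  -- `C` is the fixed point of `C = M + q * C`: `M` bounds the vertex's own term, and `q * C` its
  -- subtrees.
  set C := M * (1 - q)⁻¹ with hC
  have hC0 : 0 ≤ C := by positivity
  have hspos : 0 < s.toReal := ENNReal.toReal_pos (zero_lt_one.trans_le hs).ne' hs'
  have hm : ∀ j ∈ N, deriv Ψ (Real.log (R j)) * S j ≤ C * θ j := fun j hj =>
    ih _ (card_removeVertex_lt (hN hj)) hsub (hadm j hj) j (hpos j hj) rfl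
  have hm0 : ∀ j, 0 ≤ deriv Ψ (Real.log (R j)) * S j := fun j =>
    mul_nonneg (hΨ.deriv_pos _).le (rowSum_nonneg hθ j)
  have hchild : χ * ∑ j ∈ N, |edgeInfluence β γ (R j)| * S j ≤ C * (q * θ w) := by
    rcases Nat.eq_zero_or_pos N.card with h0 | h1
    · rw [Finset.card_eq_zero.1 h0]
      -- Without children the claim is `0 ≤ C * (q * θ w)`; the hypothesis on `θ` for the empty set
      -- supplies the sign of `q * θ w`.
      have := hθq w ∅ (Finset.empty_subset _)
      rw [Finset.sum_empty, Real.zero_rpow (one_div_pos.2 hspos).ne', mul_zero] at this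
      simpa using mul_nonneg hC0 this
    have key := hΨ.contraction_pinned hs hs' hβ hγ hδ N K h1 hK (fun j => Real.log (R j))
      (fun j => deriv Ψ (Real.log (R j)) * S j) (fun j _ => hm0 j) ht ht0
    rw [← log_ratio_eq hβ hγ hlam ht0 hpos, ← hR] at key
    have e1 : ∑ j ∈ N, |gradH β γ (Real.log (R j))| / deriv Ψ (Real.log (R j)) *
        (deriv Ψ (Real.log (R j)) * S j) = ∑ j ∈ N, |edgeInfluence β γ (R j)| * S j := by
      refine Finset.sum_congr rfl fun j hj => ?_
      rw [gradH_eq_edgeInfluence, Real.exp_log (hpos j hj), ← mul_assoc,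
        div_mul_cancel₀ _ (hΨ.deriv_pos _).ne']
    rw [e1] at key
    refine key.trans ?_
    calc δ ^ (s⁻¹).toReal *
          (∑ j ∈ N, (deriv Ψ (Real.log (R j)) * S j) ^ s.toReal) ^ (1 / s.toReal)
        ≤ δ ^ (s⁻¹).toReal * (∑ j ∈ N, (C * θ j) ^ s.toReal) ^ (1 / s.toReal) := by
          refine mul_le_mul_of_nonneg_left (Real.rpow_le_rpow
            (Finset.sum_nonneg fun j _ => Real.rpow_nonneg (hm0 j) _)
            (Finset.sum_le_sum fun j hj => Real.rpow_le_rpow (hm0 j) (hm j hj) hspos.le)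
            (one_div_nonneg.2 hspos.le)) (Real.rpow_nonneg hδ _)
      _ = C * (δ ^ (s⁻¹).toReal * (∑ j ∈ N, θ j ^ s.toReal) ^ (1 / s.toReal)) := by
          have : ∑ j ∈ N, (C * θ j) ^ s.toReal = C ^ s.toReal * ∑ j ∈ N, θ j ^ s.toReal := by
            rw [Finset.mul_sum]
            exact Finset.sum_congr rfl fun j _ => Real.mul_rpow hC0 (hθ j).le
          rw [this, Real.mul_rpow (Real.rpow_nonneg hC0 _)
            (Finset.sum_nonneg fun j _ => Real.rpow_nonneg (hθ j).le _), one_div,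
            Real.rpow_rpow_inv hC0 hspos.ne']
          ring
      _ ≤ C * (q * θ w) := mul_le_mul_of_nonneg_left (hθq w N (hN.trans fun j hj =>
          mem_nbrs.2 (hE (mem_nbrs.1 hj)))) hC0
  calc χ * rowSum β γ θ E a w ≤ χ * (θ w + ∑ j ∈ N, |edgeInfluence β γ (R j)| * S j) :=
        mul_le_mul_of_nonneg_left hrow hχpos.le
    _ ≤ M * θ w + C * (q * θ w) := by
        rw [mul_add]
        exact add_le_add (mul_le_mul_of_nonneg_right hχM (hθ w).le) hchild
    _ = C * θ w := by
        rw [hC]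
        field_simp
        ring

/-- The bound on the weighted row sum at the root. -/
theorem rowSum_le (hΨ : IsPotential Δ β γ lam s δ c Ψ) (hs : 1 ≤ s) (hs' : s ≠ ⊤)
    (hβ : 0 ≤ β) (hγ : 0 < γ) (hlam : 0 < lam) (hδ : 0 ≤ δ) (hc : 0 ≤ c) {θ : V → ℝ}
    (hθ : ∀ v, 0 < θ v) (hE : ∀ e ∈ E, ¬ e.IsDiag) {q : ℝ} (hq : q < 1)
    (hθq : ∀ w, ∀ N ⊆ nbrs E w,
      δ ^ (s⁻¹).toReal * (∑ j ∈ N, θ j ^ s.toReal) ^ (1 / s.toReal) ≤ q * θ w)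
    (ha : Admissible β γ lam Δ E a) (w : V) (hw : 0 < spinRatio β γ E a w) :
    rowSum β γ θ E a w ≤ θ w + c * (1 - q)⁻¹ * ∑ j ∈ nbrs E w, θ j := by
  obtain ⟨b, N, K, t, hN, hK, ht0, ht, hadm, hpos, hR, hrow⟩ :=
    exists_rowSum_recursion hβ hγ hlam hE ha hθ w hw
  have h1q : 0 < 1 - q := sub_pos.2 hq
  refine hrow.trans (add_le_add_right ?_ _)
  rw [Finset.mul_sum]
  refine (Finset.sum_le_sum fun j hj => ?_).trans (Finset.sum_le_sum_of_subset_of_nonneg hN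
    fun j _ _ => mul_nonneg (mul_nonneg hc (inv_nonneg.2 h1q.le)) (hθ j).le)
  have hsub : removeVertex E w ⊆ E := Finset.filter_subset _ _
  set R := spinRatio β γ (removeVertex E w) (b j) j with hRdef
  rcases (abs_nonneg (edgeInfluence β γ R)).eq_or_lt with h0 | h0
  · rw [← h0, zero_mul]
    exact mul_nonneg (mul_nonneg hc (inv_nonneg.2 h1q.le)) (hθ j).le
  have hχ : 0 < deriv Ψ (Real.log R) := hΨ.deriv_pos _
  -- The child is expanded once more only to see that its log-ratio lies in `J`.
  obtain ⟨b', N', K', t', hN', hK', ht0', ht', -, hpos', hR', -⟩ :=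
    exists_rowSum_recursion hβ hγ hlam (fun e he => hE e (hsub he)) (hadm j hj) hθ j (hpos j hj)
  have hmem : Real.log R ∈ logRatios Δ β γ lam := by
    rw [hRdef, hR']
    exact log_spinRatio_mem hβ hγ hlam hK' ht0' ht' hpos'
  -- Boundedness with `z₂` the log-ratio of this child bounds `deriv Ψ` on `J` by this `M`. Its
  -- factors `deriv Ψ` and `|edgeInfluence|` then cancel, and only `c` remains.
  have key := deriv_mul_rowSum_le hΨ hs hs' hβ hγ hlam hδ hθ hE hq hθq
    (M := c * deriv Ψ (Real.log R) / |edgeInfluence β γ R|) (fun z hz => by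
      have := hΨ.boundedness z hz _ hmem
      rw [gradH_eq_edgeInfluence, Real.exp_log (hpos j hj), ← mul_div_assoc, div_le_iff₀ hχ] at this
      rwa [le_div_iff₀ h0]) hsub (hadm j hj) j (hpos j hj)
  have h2 : c * deriv Ψ (Real.log R) / |edgeInfluence β γ R| * (1 - q)⁻¹ * θ j
      = deriv Ψ (Real.log R) * (c * (1 - q)⁻¹ * θ j / |edgeInfluence β γ R|) := by
    field_simp
  rw [h2] at key
  have := le_of_mul_le_mul_left key hχ
  rwa [le_div_iff₀ h0, mul_comm] at this

end Bound
end TwoSpin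
end

noncomputable section
namespace TwoSpin
-- Spectral radius bounds and the Perron eigenvector.
section Spectral

lemma exists_eigenvector {n : Type*} [Fintype n] [DecidableEq n] {M : Matrix n n ℂ} {μ : ℂ}
    (h : μ ∈ spectrum ℂ M) : ∃ x : n → ℂ, x ≠ 0 ∧ M.mulVec x = μ • x := by
  rw [← Matrix.spectrum_toLin', ← Module.End.hasEigenvalue_iff_mem_spectrum] at h
  obtain ⟨x, hx⟩ := h.exists_hasEigenvector
  exact ⟨x, hx.2, by simpa using hx.apply_eq_smul⟩

/-- Weighted row sums bound the spectral radius. -/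
lemma specRadius_le_of_row_sum_le {n : Type*} [Fintype n] [DecidableEq n] (M : Matrix n n ℝ)
    (θ : n → ℝ) (hθ : ∀ i, 0 < θ i) (B : ℝ) (hB : ∀ i, ∑ j, |M i j| * θ j ≤ B * θ i) :
    specRadius M ≤ ENNReal.ofReal B := by
  refine iSup₂_le fun μ hμ => ?_
  obtain ⟨x, hx0, hx⟩ := exists_eigenvector hμ
  obtain ⟨k, hk⟩ := Function.ne_iff.1 hx0
  have : Nonempty n := ⟨k⟩
  -- The eigenvalue equation is read off at a coordinate that is maximal relative to `θ`.
  obtain ⟨i, hi⟩ := Finite.exists_max fun i => ‖x i‖ / θ i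
  set t := ‖x i‖ / θ i with ht
  have hle : ∀ j, ‖x j‖ ≤ t * θ j := fun j => (div_le_iff₀ (hθ j)).1 (hi j)
  have htpos : 0 < t := (div_pos (norm_pos_iff.2 hk) (hθ k)).trans_le (hi k)
  have hxi : ‖x i‖ = t * θ i := (div_eq_iff (hθ i).ne').1 ht.symm
  have key : ‖μ‖ * (t * θ i) ≤ B * (t * θ i) := by
    have h1 : μ * x i = ∑ j, (M i j : ℂ) * x j := by
      have := congrFun hx i
      simpa [Matrix.mulVec, dotProduct] using this.symm
    calc ‖μ‖ * (t * θ i) = ‖μ * x i‖ := by rw [norm_mul, hxi]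
      _ ≤ ∑ j, |M i j| * ‖x j‖ := by
        rw [h1]
        refine (norm_sum_le _ _).trans (Finset.sum_le_sum fun j _ => ?_)
        rw [norm_mul, Complex.norm_real, Real.norm_eq_abs]
      _ ≤ ∑ j, t * (|M i j| * θ j) := Finset.sum_le_sum fun j _ => by
        rw [mul_left_comm]
        exact mul_le_mul_of_nonneg_left (hle j) (abs_nonneg _)
      _ ≤ t * (B * θ i) := by
        rw [← Finset.mul_sum]
        exact mul_le_mul_of_nonneg_left (hB i) htpos.le
      _ = B * (t * θ i) := by ring
  have := le_of_mul_le_mul_right key (mul_pos htpos (hθ i))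
  change ‖μ‖ₑ ≤ _
  rw [← ofReal_norm]
  exact ENNReal.ofReal_le_ofReal this

open scoped Matrix.Norms.L2Operator in
/-- The Perron eigenvector of a connected graph. -/
theorem exists_pos_eigenvector {V : Type*} [Fintype V] [DecidableEq V] (G : SimpleGraph V)
    [DecidableRel G.Adj] (hG : G.Connected) (r : ℝ) (hr0 : 0 ≤ r)
    (hr : specRadius (G.adjMatrix ℝ) = ENNReal.ofReal r) :
    ∃ f : V → ℝ, (∀ v, 0 < f v) ∧ ∀ v, ∑ u ∈ G.neighborFinset v, f u = r * f v := by
  have : Nonempty V := hG.nonempty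
  set A : Matrix V V ℂ := (G.adjMatrix ℝ).map (fun x : ℝ => (x : ℂ)) with hA
  have hA' : A = G.adjMatrix ℂ := by
    ext i j
    simp only [hA, Matrix.map_apply, SimpleGraph.adjMatrix_apply]
    split_ifs <;> simp
  have hsa : IsSelfAdjoint A := by
    rw [hA']
    ext i j
    simp [Matrix.star_apply, SimpleGraph.adjMatrix_apply, G.adj_comm]
  have hnorm : ‖A‖ = r := by
    rw [← hsa.toReal_spectralRadius_complex_eq_norm]
    change (specRadius (G.adjMatrix ℝ)).toReal = r
    rw [hr, ENNReal.toReal_ofReal hr0]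
  obtain ⟨μ, hμ, hμr⟩ := spectrum.exists_nnnorm_eq_spectralRadius A
  have hμ' : ‖μ‖ = r := by
    have := congrArg ENNReal.toReal hμr
    rw [hsa.toReal_spectralRadius_complex_eq_norm, hnorm] at this
    simpa using this
  obtain ⟨x, hx0, hx⟩ := exists_eigenvector hμ
  have happ : ∀ y : V → ℂ, ∀ v, A.mulVec y v = ∑ u ∈ G.neighborFinset v, y u := by
    intro y v
    rw [hA', SimpleGraph.adjMatrix_mulVec_apply]
  -- The moduli of an extremal eigenvector satisfy `A f ≥ r f` entrywise. As `A` is self-adjoint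
  -- with norm `r`, also `‖A f‖ ≤ r ‖f‖` in the Euclidean norm, so equality holds in every entry.
  let f : V → ℝ := fun v => ‖x v‖
  have hf0 : ∀ v, 0 ≤ f v := fun v => norm_nonneg _
  have hle : ∀ v, r * f v ≤ ∑ u ∈ G.neighborFinset v, f u := by
    intro v
    have h1 : μ * x v = ∑ u ∈ G.neighborFinset v, x u := by
      rw [← happ, hx]
      rfl
    rw [← hμ', ← norm_mul, h1]
    exact norm_sum_le _ _
  have hL2 : ∑ v, (∑ u ∈ G.neighborFinset v, f u) ^ 2 ≤ ∑ v, (r * f v) ^ 2 := by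
    have h1 := Matrix.l2_opNorm_mulVec A (WithLp.toLp 2 fun v => (f v : ℂ))
    rw [hnorm] at h1
    have h2 := pow_le_pow_left₀ (norm_nonneg _) h1 2
    rw [mul_pow, EuclideanSpace.norm_sq_eq, EuclideanSpace.norm_sq_eq, Finset.mul_sum] at h2
    refine (le_of_eq_of_le (Finset.sum_congr rfl fun v _ => ?_) h2).trans_eq
      (Finset.sum_congr rfl fun v _ => ?_)
    · change _ = ‖A.mulVec (fun v => (f v : ℂ)) v‖ ^ 2
      rw [happ, ← Complex.ofReal_sum, Complex.norm_real, Real.norm_eq_abs, sq_abs]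
    · change r ^ 2 * ‖(f v : ℂ)‖ ^ 2 = _
      rw [Complex.norm_real, Real.norm_eq_abs, sq_abs, mul_pow]
  have heq : ∀ v, ∑ u ∈ G.neighborFinset v, f u = r * f v := by
    have h3 : ∀ v ∈ Finset.univ, (r * f v) ^ 2 ≤ (∑ u ∈ G.neighborFinset v, f u) ^ 2 :=
      fun v _ => pow_le_pow_left₀ (mul_nonneg hr0 (hf0 v)) (hle v) 2
    have h4 := (Finset.sum_eq_sum_iff_of_le h3).1 (le_antisymm (Finset.sum_le_sum h3) hL2)
    intro v
    exact ((sq_eq_sq₀ (mul_nonneg hr0 (hf0 v))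
      (Finset.sum_nonneg fun u _ => hf0 u)).1 (h4 v (Finset.mem_univ v))).symm
  refine ⟨f, fun v => (hf0 v).lt_of_ne' fun hv => hx0 ?_, heq⟩
  -- At a zero of `f`, the nonnegative values at the neighbours sum to zero. By connectivity a
  -- single zero would make `f`, and hence `x`, vanish.
  have hstep : ∀ a b, G.Adj a b → f a = 0 → f b = 0 := by
    intro a b hab ha
    have h5 := heq a
    rw [ha, mul_zero, Finset.sum_eq_zero_iff_of_nonneg fun u _ => hf0 u] at h5
    exact h5 b (by simpa using hab)
  have hall : ∀ u, f u = 0 := by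
    intro u
    obtain ⟨p⟩ := hG.preconnected v u
    induction p with
    | nil => exact hv
    | cons h _ ih => exact ih (hstep _ _ h hv)
  ext u
  exact norm_eq_zero.1 (hall u)

end Spectral
end TwoSpin
end

noncomputable section
set_option linter.unusedSectionVars false
namespace TwoSpin
-- Reduction of the pinned Gibbs distribution, and the final estimate.
section Main
variable {V : Type*} [Fintype V] [DecidableEq V] {β γ lam : ℝ} {Δ : ℕ}

/-- The indicator of the event that a configuration agrees with `η` on `Λ`. -/
def pinInd (Λ : Finset V) (η σ : V → Bool) : ℝ := if ∀ v ∈ Λ, σ v = η v then 1 else 0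

lemma pinInd_insert (w : V) (Λ : Finset V) (η σ : V → Bool) :
    pinInd (insert w Λ) η σ = pinInd Λ η σ * spinInd w (η w) σ := by
  by_cases h1 : ∀ v ∈ Λ, σ v = η v <;> by_cases h2 : σ w = η w <;> simp [pinInd, spinInd, h1, h2]

/-- Pinning a set of vertices gives a two-spin model on the remaining edges. -/
theorem exists_pinned_model (hβ : 0 ≤ β) (hγ : 0 < γ) (hlam : 0 < lam) {E₀ : Finset (Sym2 V)}
    (hE₀ : ∀ e ∈ E₀, ¬ e.IsDiag) {a₀ : V → ℝ} (ha₀ : Admissible β γ lam Δ E₀ a₀)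
    (η : V → Bool) (Λ : Finset V) :
    ∃ (E : Finset (Sym2 V)) (a : V → ℝ) (C : ℝ), E ⊆ E₀ ∧ Admissible β γ lam Δ E a ∧
      ∀ g : (V → Bool) → ℝ, (∀ w ∈ Λ, ∀ σ b, g (Function.update σ w b) = g σ) →
        modelSum β γ E₀ a₀ (fun σ => pinInd Λ η σ * g σ) = C * modelSum β γ E a g := by
  induction Λ using Finset.induction_on with
  | empty => exact ⟨E₀, a₀, 1, subset_rfl, ha₀, fun g _ => by simp [pinInd]⟩
  | insert w Λ hw ih =>
    obtain ⟨E, a, C, hE, ha, hC⟩ := ih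
    have hdiag : ∀ e ∈ E, ¬ e.IsDiag := fun e he => hE₀ e (hE he)
    have hpos : (1 + a w) ≠ 0 := by
      have := ha.nonneg hβ hγ hlam w
      positivity
    have hadm : ∀ x, x = β ∨ x = γ⁻¹ →
        Admissible β γ lam Δ (removeVertex E w) (scaleOn a (nbrs E w) x) := by
      intro x hx
      refine ha.removeVertex hβ hγ fun v => ?_
      by_cases hv : v ∈ nbrs E w
      · rw [scaleOn_of_mem hv]
        rcases hx with rfl | rfl <;> simp [hv]
      · exact Or.inl (scaleOn_of_notMem hv)
    have hstep : ∀ g : (V → Bool) → ℝ,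
        (∀ v ∈ insert w Λ, ∀ σ b, g (Function.update σ v b) = g σ) →
        modelSum β γ E₀ a₀ (fun σ => pinInd (insert w Λ) η σ * g σ)
          = C * modelSum β γ E a (fun σ => spinInd w (η w) σ * g σ) := by
      intro g hg
      rw [← hC fun σ => spinInd w (η w) σ * g σ]
      · simp only [pinInd_insert, mul_assoc]
      · intro v hv σ b
        rw [hg v (Finset.mem_insert_of_mem hv),
          spinInd_update_of_ne (by rintro rfl; exact hw hv)]
    have hsub : removeVertex E w ⊆ E₀ := (Finset.filter_subset _ _).trans hE
    cases hη : η w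
    · refine ⟨removeVertex E w, scaleOn a (nbrs E w) γ⁻¹, C * (γ ^ (nbrs E w).card / (1 + a w)),
        hsub, hadm _ (Or.inr rfl), fun g hg => ?_⟩
      rw [hstep g hg, hη, mul_assoc, div_mul_eq_mul_div,
        ← modelSum_cond_false hγ hdiag (hg w (Finset.mem_insert_self _ _)),
        mul_div_cancel_left₀ _ hpos]
    · refine ⟨removeVertex E w, scaleOn a (nbrs E w) β, C * (a w / (1 + a w)),
        hsub, hadm _ (Or.inl rfl), fun g hg => ?_⟩
      rw [hstep g hg, hη, mul_assoc, div_mul_eq_mul_div,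
        ← modelSum_cond_true hdiag (hg w (Finset.mem_insert_self _ _)),
        mul_div_cancel_left₀ _ hpos]

/-- Each row of the influence matrix of a pinned Gibbs distribution is zero or a row of influences
in the pinned model. -/
theorem exists_influenceMatrix_eq (G : SimpleGraph V) [DecidableRel G.Adj] (hβ : 0 ≤ β)
    (hγ : 0 < γ) (hlam : 0 < lam) (hΔ : G.maxDegree ≤ Δ) (Λ : Finset V)
    (τ : {v // v ∈ Λ} → Bool) :
    ∃ (E : Finset (Sym2 V)) (a : V → ℝ), E ⊆ G.edgeFinset ∧ Admissible β γ lam Δ E a ∧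
      ∀ w, (∀ u, influenceMatrix G β γ lam Λ τ w u = 0) ∨
        0 < spinRatio β γ E a w ∧
          ∀ u, influenceMatrix G β γ lam Λ τ w u = influence β γ E a w u := by
  have hnbrs : ∀ v, nbrs G.edgeFinset v = G.neighborFinset v := fun v => by
    ext u
    simp [mem_nbrs]
  have ha₀ : Admissible β γ lam Δ G.edgeFinset fun _ => lam := fun v =>
    ⟨0, 1, by rw [hnbrs, zero_add]; exact (G.degree_le_maxDegree v).trans hΔ, by simp, by simp⟩
  have hE₀ : ∀ e ∈ G.edgeFinset, ¬ e.IsDiag := fun e he =>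
    G.not_isDiag_of_mem_edgeSet (SimpleGraph.mem_edgeFinset.1 he)
  -- The values of `η` outside `Λ` are arbitrary.
  let η : V → Bool := fun v => if h : v ∈ Λ then τ ⟨v, h⟩ else true
  obtain ⟨E, a, C, hE, ha, hC⟩ := exists_pinned_model hβ hγ hlam hE₀ ha₀ η Λ
  refine ⟨E, a, hE, ha, fun w => ?_⟩
  set Z := modelSum β γ G.edgeFinset (fun _ => lam) fun _ => 1 with hZ
  have hZpos : 0 < Z := modelSum_one_pos hβ hγ fun _ => hlam.le
  have hpin : ∀ σ, σ ∈ pinned Λ τ ↔ ∀ v ∈ Λ, σ v = η v := by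
    intro σ
    constructor
    · intro h v hv
      simpa [η, hv] using h ⟨v, hv⟩
    · intro h v
      simpa [η] using h v v.2
  have hprob : ∀ (S : Set (V → Bool)) (g : (V → Bool) → ℝ),
      (∀ v ∈ Λ, ∀ σ b, g (Function.update σ v b) = g σ) →
      (∀ σ, (σ ∈ S → pinInd Λ η σ * g σ = 1) ∧ (σ ∉ S → pinInd Λ η σ * g σ = 0)) →
      gibbsProb G β γ lam S = C / Z * modelSum β γ E a g := by
    intro S g hg hS
    have hZ' : ∑ σ' : V → Bool, weight G β γ lam σ' = Z := by
      rw [hZ, modelSum]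
      exact Finset.sum_congr rfl fun σ _ => by rw [weight_eq_modelWeight, mul_one]
    rw [div_mul_eq_mul_div, ← hC g hg, gibbsProb, modelSum, Finset.sum_div]
    refine Finset.sum_congr rfl fun σ _ => ?_
    split_ifs with h
    · rw [(hS σ).1 h, gibbs, hZ', weight_eq_modelWeight, mul_one]
    · rw [(hS σ).2 h, mul_zero, zero_div]
  have hne : ∀ (x : {v // v ∉ Λ}) v, v ∈ Λ → (x : V) ≠ v := fun x v hv h => x.2 (h ▸ hv)
  have h1 : ∀ b, gibbsProb G β γ lam (pinned Λ τ ∩ spinAt w b)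
      = C / Z * modelSum β γ E a (spinInd w b) := fun b => by
    refine hprob _ _ (fun v hv σ c => spinInd_update_of_ne (hne w v hv) _ _ _) fun σ => ?_
    rw [Set.mem_inter_iff, hpin]
    change ((_ ∧ σ w = b) → _) ∧ (¬ (_ ∧ σ w = b) → _)
    by_cases h1 : ∀ v ∈ Λ, σ v = η v <;> by_cases h2 : σ w = b <;> simp [pinInd, spinInd, h1, h2]
  have h2 : ∀ b (u : {v // v ∉ Λ}),
      gibbsProb G β γ lam (spinAt u true ∩ (pinned Λ τ ∩ spinAt w b))
      = C / Z * modelSum β γ E a fun σ => spinInd (w : V) b σ * spinInd (u : V) true σ := fun b u => by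
    refine hprob _ _ (fun v hv σ c => ?_) fun σ => ?_
    · rw [spinInd_update_of_ne (hne w v hv), spinInd_update_of_ne (hne u v hv)]
    rw [Set.mem_inter_iff, Set.mem_inter_iff, hpin]
    change ((σ u = true ∧ _ ∧ σ w = b) → _) ∧ (¬ (σ u = true ∧ _ ∧ σ w = b) → _)
    by_cases h1 : ∀ v ∈ Λ, σ v = η v <;> by_cases h2 : σ w = b <;> by_cases h3 : σ u = true <;>
      simp [pinInd, spinInd, h1, h2, h3]
  by_cases hcond : gibbsProb G β γ lam (pinned Λ τ ∩ spinAt w true) ≠ 0 ∧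
      gibbsProb G β γ lam (pinned Λ τ ∩ spinAt w false) ≠ 0
  · right
    have hcond' := hcond
    rw [h1, h1] at hcond'
    -- The constant `C` is zero if the pinning has probability zero. Here a conditioning event of
    -- nonzero probability excludes this, so `C / Z` cancels.
    have hCZ : C / Z ≠ 0 := left_ne_zero_of_mul hcond'.1
    have hne1 := right_ne_zero_of_mul hcond'.1
    have hnn := ha.nonneg hβ hγ hlam
    refine ⟨div_pos ((modelSum_nonneg hβ hγ hnn (spinInd_nonneg _ _)).lt_of_ne' hne1)
      (modelSum_spinInd_false_pos hβ hγ hnn _), fun u => ?_⟩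
    rw [influenceMatrix, if_pos hcond, condMarginal, condMarginal, h2, h2, h1, h1,
      mul_div_mul_left _ _ hCZ, mul_div_mul_left _ _ hCZ, influence]
  · left
    intro u
    rw [influenceMatrix, if_neg hcond]

/-- The weighted row sum of influences, with weights from a positive eigenvector `f` of the
graph. -/
theorem rowSum_eigenvector_le {s : ℝ≥0∞} {Ψ : ℝ → ℝ} {ρ ε ζ : ℝ} (hρ : 0 < ρ)
    (hΨ : IsPotential Δ β γ lam s ((1 - ε) / ρ) (ζ / ρ) Ψ) (hs : 1 ≤ s) (hs' : s ≠ ⊤)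
    (hε0 : 0 < ε) (hε1 : ε < 1) (hζ : 0 < ζ) (hβ : 0 ≤ β) (hγ : 0 < γ) (hlam : 0 < lam)
    (hΔ : 0 < Δ) {E : Finset (Sym2 V)} {a f : V → ℝ} (hE : ∀ e ∈ E, ¬ e.IsDiag)
    (ha : Admissible β γ lam Δ E a) (hf : ∀ v, 0 < f v)
    (hfe : ∀ w, ∑ j ∈ nbrs E w, f j ≤ ρ * f w) (w : V) (hw : 0 < spinRatio β γ E a w) :
    rowSum β γ (fun v => f v ^ (s⁻¹).toReal) E a w
      ≤ (1 + ζ * (1 - (1 - ε) ^ (s⁻¹).toReal)⁻¹ * (Δ / ρ) ^ (1 - (s⁻¹).toReal))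
        * f w ^ (s⁻¹).toReal := by
  have hΔ0 : (0 : ℝ) < Δ := by exact_mod_cast hΔ
  have hε : 0 < 1 - ε := sub_pos.2 hε1
  have hspos : 0 < s.toReal := ENNReal.toReal_pos (zero_lt_one.trans_le hs).ne' hs'
  have hs1 : 1 ≤ s.toReal := by
    simpa using (ENNReal.toReal_le_toReal ENNReal.one_ne_top hs').2 hs
  have hpr : (s⁻¹).toReal = 1 / s.toReal := by rw [ENNReal.toReal_inv, one_div]
  have hp0 : 0 < (s⁻¹).toReal := by rw [hpr]; positivity
  have hps : (s⁻¹).toReal * s.toReal = 1 := by rw [hpr]; field_simp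
  have hq1 : (1 - ε) ^ (s⁻¹).toReal < 1 := Real.rpow_lt_one hε.le (by linarith) hp0
  have h1q := sub_pos.2 hq1
  have hθ : ∀ v, 0 < f v ^ (s⁻¹).toReal := fun v => Real.rpow_pos_of_pos (hf v) _
  have hθs : ∀ v, (f v ^ (s⁻¹).toReal) ^ s.toReal = f v := fun v => by
    rw [← Real.rpow_mul (hf v).le, hps, Real.rpow_one]
  have hfN : ∀ w, ∀ N ⊆ nbrs E w, ∑ j ∈ N, f j ≤ ρ * f w := fun w N hN =>
    (Finset.sum_le_sum_of_subset_of_nonneg hN fun j _ _ => (hf j).le).trans (hfe w)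
  have hsum0 : ∀ N : Finset V, 0 ≤ ∑ j ∈ N, f j := fun N =>
    Finset.sum_nonneg fun j _ => (hf j).le
  -- Since `θ ^ s = f`, the left side is `((1 - ε) / ρ * ∑ f) ^ (1/s)`, and the eigenvector
  -- inequality cancels `ρ`.
  have hθq : ∀ w, ∀ N ⊆ nbrs E w, ((1 - ε) / ρ) ^ (s⁻¹).toReal *
      (∑ j ∈ N, (f j ^ (s⁻¹).toReal) ^ s.toReal) ^ (1 / s.toReal)
      ≤ (1 - ε) ^ (s⁻¹).toReal * f w ^ (s⁻¹).toReal := fun w N hN => by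
    rw [Finset.sum_congr rfl fun j _ => hθs j, ← hpr,
      ← Real.mul_rpow (div_nonneg hε.le hρ.le) (hsum0 N), ← Real.mul_rpow hε.le (hf w).le]
    refine Real.rpow_le_rpow (mul_nonneg (div_nonneg hε.le hρ.le) (hsum0 N)) ?_ hp0.le
    calc (1 - ε) / ρ * ∑ j ∈ N, f j ≤ (1 - ε) / ρ * (ρ * f w) :=
          mul_le_mul_of_nonneg_left (hfN w N hN) (div_nonneg hε.le hρ.le)
      _ = (1 - ε) * f w := by field_simp
  have hsumθ : ∑ j ∈ nbrs E w, f j ^ (s⁻¹).toReal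
      ≤ (Δ : ℝ) ^ (1 - (s⁻¹).toReal) * ρ ^ (s⁻¹).toReal * f w ^ (s⁻¹).toReal := by
    have h0 : 0 ≤ ∑ j ∈ nbrs E w, f j ^ (s⁻¹).toReal := Finset.sum_nonneg fun j _ => (hθ j).le
    -- Power mean inequality: `(∑ θ) ^ s ≤ card ^ (s - 1) * ∑ θ ^ s`, where `card ≤ Δ` by
    -- admissibility.
    have h1 := Real.rpow_sum_le_const_mul_sum_rpow_of_nonneg (s := nbrs E w)
      (f := fun j => f j ^ (s⁻¹).toReal) hs1 fun j _ => (hθ j).le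
    rw [Finset.sum_congr rfl fun j _ => hθs j] at h1
    have hcard : ((nbrs E w).card : ℝ) ≤ Δ := by
      obtain ⟨k, -, hk, -⟩ := ha w
      exact_mod_cast (Nat.le_add_left _ k).trans hk
    have h2 := h1.trans (mul_le_mul (Real.rpow_le_rpow (Nat.cast_nonneg _) hcard (sub_nonneg.2 hs1))
        (hfN w _ subset_rfl) (hsum0 _) (Real.rpow_nonneg hΔ0.le _))
    have h3 := Real.rpow_le_rpow (Real.rpow_nonneg h0 _) h2 hp0.le
    rw [← Real.rpow_mul h0, mul_comm s.toReal, hps, Real.rpow_one,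
      Real.mul_rpow (Real.rpow_nonneg hΔ0.le _) (mul_nonneg hρ.le (hf w).le),
      Real.mul_rpow hρ.le (hf w).le, ← Real.rpow_mul hΔ0.le,
      show (s.toReal - 1) * (s⁻¹).toReal = 1 - (s⁻¹).toReal by
        rw [sub_mul, mul_comm, hps, one_mul], ← mul_assoc] at h3
    exact h3
  have hc : 0 ≤ ζ / ρ := div_nonneg hζ.le hρ.le
  refine (rowSum_le hΨ hs hs' hβ hγ hlam (div_nonneg hε.le hρ.le) hc hθ hE hq1 hθq ha w hw).trans
    ((add_le_add_right (mul_le_mul_of_nonneg_left hsumθ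
      (mul_nonneg hc (inv_nonneg.2 h1q.le))) _).trans_eq ?_)
  rw [Real.div_rpow hΔ0.le hρ.le, Real.rpow_sub hρ, Real.rpow_one]
  have h4 := (Real.rpow_pos_of_pos hρ (s⁻¹).toReal).ne'
  generalize (1 - (1 - ε) ^ (s⁻¹).toReal)⁻¹ = C
  generalize ρ ^ (s⁻¹).toReal = x at *
  generalize (Δ : ℝ) ^ (1 - (s⁻¹).toReal) = y
  generalize f w ^ (s⁻¹).toReal = z
  have := hρ.ne'
  field_simp

lemma ofReal_spectral_bound {ζ ε x p : ℝ} (hζ : 0 < ζ) (hε0 : 0 < ε) (hε1 : ε < 1) (hx : 0 < x)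
    (hp : 0 < p) :
    ENNReal.ofReal (1 + ζ * (1 - (1 - ε) ^ p)⁻¹ * x ^ (1 - p))
      = 1 + ENNReal.ofReal ζ * (1 - ENNReal.ofReal (1 - ε) ^ p)⁻¹
        * ENNReal.ofReal x ^ (1 - p) := by
  have hε : 0 < 1 - ε := sub_pos.2 hε1
  have h1q : 0 < 1 - (1 - ε) ^ p := sub_pos.2 (Real.rpow_lt_one hε.le (by linarith) hp)
  have hx' : 0 ≤ x ^ (1 - p) := Real.rpow_nonneg hx.le _
  have hC : 0 ≤ ζ * (1 - (1 - ε) ^ p)⁻¹ := mul_nonneg hζ.le (inv_nonneg.2 h1q.le)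
  rw [ENNReal.ofReal_add zero_le_one (mul_nonneg hC hx'), ENNReal.ofReal_one,
    ENNReal.ofReal_mul hC, ENNReal.ofReal_mul hζ.le, ENNReal.ofReal_inv_of_pos h1q,
    ENNReal.ofReal_sub _ (Real.rpow_nonneg hε.le _), ENNReal.ofReal_one,
    ENNReal.ofReal_rpow_of_pos hε, ENNReal.ofReal_rpow_of_pos hx]

lemma sum_subtype_le_rowSum (Λ : Finset V) {θ : V → ℝ} (hθ : ∀ v, 0 < θ v)
    (E : Finset (Sym2 V)) (a : V → ℝ) (w : V) :
    ∑ u : {v // v ∉ Λ}, |influence β γ E a w u| * θ u ≤ rowSum β γ θ E a w := by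
  rw [rowSum, ← Finset.sum_subtype (Finset.univ.filter (· ∉ Λ)) (by simp)
    fun u => |influence β γ E a w u| * θ u]
  exact Finset.sum_le_sum_of_subset_of_nonneg (Finset.filter_subset _ _)
    fun u _ _ => mul_nonneg (abs_nonneg _) (hθ u).le

end Main
end TwoSpin
end

open TwoSpin

theorem theorem5p5 {V : Type*} [Fintype V] [DecidableEq V]
    (G : SimpleGraph V) [DecidableRel G.Adj] (hG : G.Connected)
    (Δ : ℕ) (hΔ : 1 ≤ Δ) (hGΔ : G.maxDegree = Δ)
    (ρG : ℝ) (hρ : 1 ≤ ρG) (hGρ : TwoSpin.specRadius (G.adjMatrix ℝ) = ENNReal.ofReal ρG)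
    (s : ℝ≥0∞) (hs : 1 ≤ s)
    (ε ζ : ℝ) (hε0 : 0 < ε) (hε1 : ε < 1) (hζ : 0 < ζ)
    (β γ lam : ℝ) (hγ : 0 < γ) (hβ : 0 ≤ β) (hβγ : β ≤ γ) (hlam : 0 < lam)
    (hΨ : ∃ Ψ : ℝ → ℝ, TwoSpin.IsPotential Δ β γ lam s ((1 - ε) / ρG) (ζ / ρG) Ψ)
    (Λ : Finset V) (τ : {v // v ∈ Λ} → Bool) :
    TwoSpin.specRadius (TwoSpin.influenceMatrix G β γ lam Λ τ) ≤
      1 + ENNReal.ofReal ζ * (1 - ENNReal.ofReal (1 - ε) ^ (s⁻¹).toReal)⁻¹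
        * ENNReal.ofReal (Δ / ρG) ^ (1 - (s⁻¹).toReal) := by
  have hρ0 : 0 < ρG := zero_lt_one.trans_le hρ
  have hΔ0 : (0 : ℝ) < Δ := by exact_mod_cast hΔ
  -- For `s = ∞` the exponent `1/s` is `0`, so the inverse is `(1 - 1)⁻¹ = ⊤`. The other factors are
  -- nonzero, and the bound is `⊤`.
  rcases eq_or_ne s ⊤ with hs' | hs'
  · simp [hs', ENNReal.mul_top, ENNReal.top_mul, hζ, div_pos hΔ0 hρ0]
  obtain ⟨Ψ, hΨ⟩ := hΨ
  have hp0 : 0 < (s⁻¹).toReal := by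
    rw [ENNReal.toReal_inv]
    exact inv_pos.2 (ENNReal.toReal_pos (zero_lt_one.trans_le hs).ne' hs')
  obtain ⟨f, hf, hfe⟩ := exists_pos_eigenvector G hG ρG hρ0.le hGρ
  obtain ⟨E, a, hE, ha, hrow⟩ := exists_influenceMatrix_eq G hβ hγ hlam hGΔ.le Λ τ
  have hEd : ∀ e ∈ E, ¬ e.IsDiag := fun e he =>
    G.not_isDiag_of_mem_edgeSet (SimpleGraph.mem_edgeFinset.1 (hE he))
  have hnb : ∀ w, nbrs E w ⊆ G.neighborFinset w := fun w j hj => by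
    simpa using SimpleGraph.mem_edgeFinset.1 (hE (mem_nbrs.1 hj))
  have hfE : ∀ w, ∑ j ∈ nbrs E w, f j ≤ ρG * f w := fun w =>
    (Finset.sum_le_sum_of_subset_of_nonneg (hnb w) fun j _ _ => (hf j).le).trans_eq (hfe w)
  have hθ : ∀ v, 0 < f v ^ (s⁻¹).toReal := fun v => Real.rpow_pos_of_pos (hf v) _
  have hε : 0 ≤ 1 - ε := (sub_pos.2 hε1).le
  rw [← ofReal_spectral_bound hζ hε0 hε1 (div_pos hΔ0 hρ0) hp0]
  suffices key : ∀ w : {v // v ∉ Λ},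
      ∑ u : {v // v ∉ Λ}, |influenceMatrix G β γ lam Λ τ w u| * f u ^ (s⁻¹).toReal
        ≤ (1 + ζ * (1 - (1 - ε) ^ (s⁻¹).toReal)⁻¹ * (Δ / ρG) ^ (1 - (s⁻¹).toReal))
          * f w ^ (s⁻¹).toReal from
    specRadius_le_of_row_sum_le (influenceMatrix G β γ lam Λ τ)
      (fun v : {v // v ∉ Λ} => f v ^ (s⁻¹).toReal) (fun v => hθ v) _ key
  intro w
  rcases hrow w with h | ⟨hpos, h⟩
  · simp only [h, abs_zero, zero_mul, Finset.sum_const_zero]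
    have h1 : 0 ≤ 1 - (1 - ε) ^ (s⁻¹).toReal :=
      sub_nonneg.2 (Real.rpow_le_one hε (by linarith) hp0.le)
    exact mul_nonneg (add_nonneg zero_le_one (mul_nonneg (mul_nonneg hζ.le (inv_nonneg.2 h1))
      (Real.rpow_nonneg (div_pos hΔ0 hρ0).le _))) (hθ w).le
  · simp only [h]
    exact (sum_subtype_le_rowSum Λ hθ E a w).trans (rowSum_eigenvector_le hρ0 hΨ hs hs' hε0 hε1 hζ
      hβ hγ hlam hΔ hEd ha hf hfE w hpos)
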